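/- Computations are on a word-RAM whose words have $O(\log s)$ bits, where $s$ is the size of the instance, with unit-cost arithmetic, bitwise, comparison and indirect-addressing instructions. For $k\ge 2$, the $k$-OV problem is: given $k$ collections of $n$ vectors in $\{0,1\}^d$, decide whether one can choose a vector $v_j$ from the $j$-th collection for every $j=1,\dots,k$ such that $\sum_{i=1}^d\prod_{j=1}^k v_j[i]=0$. The $k$-OV conjecture states that for no $\varepsilon>0$ is there an algorithm that solves $k$-OV in time $O(n^{k-\varepsilon}\,\mathrm{poly}(d))$. The eccentricity of a vertex $v$ of a graph is $\varepsilon(v)=\max_u d(v,u)$. A $\rho$-approximation for Eccentricities outputs for every vertex $v$ an estimate $\varepsilon'(v)$ such that $\varepsilon(v)\le\varepsilon'(v)\le\rho\,\varepsilon(v)$ for all inputs and all $v$ (approximation from above), or such that $\varepsilon(v)/\rho\le\varepsilon'(v)\le\varepsilon(v)$ for all inputs and all $v$ (approximation from below); the statements below hold for either convention. **Theorem.** Let $C\ge 2$ be an integer, and let $\mathcal G_C$ be the class of connected undirected unweighted graphs with $n$ vertices and at most $Cn$ edges (given by lists of edges), $n\ge1$. 1. For every $k\ge 2$, under the $k$-OV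 conjecture, every algorithm that, given a graph in $\mathcal G_C$, outputs one answer for each vertex which distinguishes eccentricity at most $2k-1$ from eccentricity at least $4k-3$ (with any answer allowed for a vertex of eccentricity strictly between) requires $n^{1+1/(k-1)-o(1)}$ time: for no $\varepsilon>0$ is there such an algorithm that runs in time $O(n^{1+1/(k-1)-\varepsilon})$. 2. In particular, under the $3$-OV conjecture, for all $\varepsilon,\delta>0$, no algorithm computes a $(9/5-\varepsilon)$-approximation for Eccentricities on $\mathcal G_C$ in time $O(n^{3/2-\delta})$. 3. In particular, if the $k$-OV conjecture holds for every $k\ge 2$, then for every $\varepsilon>0$ no algorithm computes a $(2-\varepsilon)$-approximation for Eccentricities on $\mathcal G_C$ in time $n^{1+o(1)}$. -/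

import Mathlib

open Filter Topology

namespace WordRAM

/-- The unit-cost operations on words. Subtraction is truncated at `0`, division and remainder are
those of `ℕ`, and comparisons return `1` for true and `0` for false. -/
inductive BinOp
  | add | sub | mul | div | mod | land | lor | xor | shl | shr | lt | eq

/-- The value of an operation, before the test that it fits into a word. -/
def BinOp.eval : BinOp → ℕ → ℕ → ℕ
  | .add, x, y => x + y
  | .sub, x, y => x - y
  | .mul, x, y => x * y
  | .div, x, y => x / y
  | .mod, x, y => x % y
  | .land, x, y => x &&& y
  | .lor, x, y => x ||| y
  | .xor, x, y => x ^^^ y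
  | .shl, x, y => x <<< y
  | .shr, x, y => x >>> y
  | .lt, x, y => if x < y then 1 else 0
  | .eq, x, y => if x = y then 1 else 0

/-- Word-RAM programs. The names `r a b` are (fixed) register numbers. -/
inductive Prog
  /-- do nothing -/
  | skip
  /-- `R[r] := v` -/
  | const (r v : ℕ)
  /-- `R[r] := R[a] o R[b]` -/
  | op (o : BinOp) (r a b : ℕ)
  /-- `R[r] := M[R[a]]` -/
  | load (r a : ℕ)
  /-- `M[R[a]] := R[b]` -/
  | store (a b : ℕ)
  /-- first `p`, then `q` -/
  | seq (p q : Prog)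
  /-- if `R[r] ≠ 0` then `p` else `q` -/
  | ite (r : ℕ) (p q : Prog)
  /-- while `R[r] ≠ 0` do `p` -/
  | loop (r : ℕ) (p : Prog)

/-- A configuration: the contents of the registers and of the random-access memory. -/
structure State where
  reg : ℕ → ℕ
  mem : ℕ → ℕ

/-- The initial configuration on input `x`: the words of `x` stand in the memory cells
`0, 1, …, x.length - 1`; all other cells and all registers are `0`. -/
def State.start (x : List ℕ) : State where
  reg := fun _ => 0
  mem := fun a => x.getD a 0

/-- `Exec w p s t s'`: on a machine with `w`-bit words the program `p`, started in the
configuration `s`, halts after exactly `t` steps in the configuration `s'`. Every executed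
instruction and every evaluated test is one step. A run in which a number that does not fit into
`w` bits would enter a register is aborted, that is, there is no such `s'`. -/
inductive Exec (w : ℕ) : Prog → State → ℕ → State → Prop
  | skip (s : State) : Exec w .skip s 1 s
  | const (s : State) (r v : ℕ) (h : v < 2 ^ w) :
      Exec w (.const r v) s 1 { s with reg := Function.update s.reg r v }
  | op (s : State) (o : BinOp) (r a b : ℕ) (h : o.eval (s.reg a) (s.reg b) < 2 ^ w) :
      Exec w (.op o r a b) s 1
        { s with reg := Function.update s.reg r (o.eval (s.reg a) (s.reg b)) }
  | load (s : State) (r a : ℕ) (h : s.mem (s.reg a) < 2 ^ w) :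
      Exec w (.load r a) s 1 { s with reg := Function.update s.reg r (s.mem (s.reg a)) }
  | store (s : State) (a b : ℕ) :
      Exec w (.store a b) s 1 { s with mem := Function.update s.mem (s.reg a) (s.reg b) }
  | seq {p q : Prog} {s₁ s₂ s₃ : State} {t u : ℕ}
      (hp : Exec w p s₁ t s₂) (hq : Exec w q s₂ u s₃) : Exec w (.seq p q) s₁ (t + u) s₃
  | ite_true {r : ℕ} {p q : Prog} {s s' : State} {t : ℕ}
      (hr : s.reg r ≠ 0) (hp : Exec w p s t s') : Exec w (.ite r p q) s (t + 1) s'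
  | ite_false {r : ℕ} {p q : Prog} {s s' : State} {t : ℕ}
      (hr : s.reg r = 0) (hq : Exec w q s t s') : Exec w (.ite r p q) s (t + 1) s'
  | loop_done {r : ℕ} {p : Prog} {s : State}
      (hr : s.reg r = 0) : Exec w (.loop r p) s 1 s
  | loop_step {r : ℕ} {p : Prog} {s₁ s₂ s₃ : State} {t u : ℕ}
      (hr : s₁.reg r ≠ 0) (hp : Exec w p s₁ t s₂) (hl : Exec w (.loop r p) s₂ u s₃) :
      Exec w (.loop r p) s₁ (t + u + 1) s₃

/-- The word size `c · (⌊log₂ s⌋ + 1)` of a machine with `O(log s)`-bit words; the constant `c` is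
chosen together with the program. -/
def wordSize (c s : ℕ) : ℕ := c * (Nat.log 2 s + 1)

/-- With `w`-bit words and on input `x`, the program `p` halts after at most `T` steps, without
overflow, with final memory contents `out` such that `Q out`. -/
def RunsWithin (p : Prog) (w : ℕ) (x : List ℕ) (T : ℝ) (Q : (ℕ → ℕ) → Prop) : Prop :=
  ∃ (t : ℕ) (s : State), Exec w p (State.start x) t s ∧ (t : ℝ) ≤ T ∧ Q s.mem

end WordRAM

open WordRAM

/-! ### Orthogonal vectors -/

/-- The `k` collections `A 0, …, A (k-1)` of `n` vectors in `{0,1}^d` each contain vectors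
`A 0 (v 0), …, A (k-1) (v (k-1))` whose generalized inner product is `0`. -/
def HasOrthogonalTuple {k n d : ℕ} (A : Fin k → Fin n → Fin d → Bool) : Prop :=
  ∃ v : Fin k → Fin n, ∑ l : Fin d, ∏ i : Fin k, (A i (v i) l).toNat = 0

/-- The encoding of an instance of `k`-OV: `n`, `d`, then all coordinates of all vectors of all
collections in lexicographic order of (collection, vector, coordinate), one word each. -/
def ovInput {k n d : ℕ} (A : Fin k → Fin n → Fin d → Bool) : List ℕ :=
  n :: d :: (List.finRange k).flatMap fun i => (List.finRange n).flatMap fun j =>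
    (List.finRange d).map fun l => (A i j l).toNat

/-- The `k`-OV conjecture: for no `ε > 0` is there a word-RAM algorithm (with words of
logarithmically many bits) that decides `k`-OV on `n` vectors per collection and dimension `d` in
time `n ^ (k - ε) · poly(d)`. The answer is "yes" if memory cell `0` is nonzero at the end. -/
def KOVConjecture (k : ℕ) : Prop :=
  ∀ ε : ℝ, 0 < ε → ¬ ∃ (p : Prog) (c : ℕ) (K : ℝ) (a : ℕ),
    ∀ n d : ℕ, 1 ≤ n → 1 ≤ d → ∀ A : Fin k → Fin n → Fin d → Bool,
      RunsWithin p (wordSize c (n * d)) (ovInput A)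
        (K * (n : ℝ) ^ ((k : ℝ) - ε) * (d : ℝ) ^ a)
        (fun out => out 0 ≠ 0 ↔ HasOrthogonalTuple A)

/-! ### Eccentricities in sparse graphs -/

/-- `L` lists every edge of `G` exactly once (with its end points in some order). -/
def IsEdgeList {n : ℕ} (G : SimpleGraph (Fin n)) (L : List (Fin n × Fin n)) : Prop :=
  (L.map fun e => s(e.1, e.2)).Nodup ∧
    ∀ u v : Fin n, G.Adj u v ↔ s(u, v) ∈ L.map fun e => s(e.1, e.2)

/-- The encoding of a graph on `n` vertices `0, …, n-1` with edge list `L`: the number of vertices,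
the number of edges, then the end points of the edges. -/
def graphInput {n : ℕ} (L : List (Fin n × Fin n)) : List ℕ :=
  n :: L.length :: L.flatMap fun e => [(e.1 : ℕ), (e.2 : ℕ)]

/-- A task on graphs: which final memory contents are correct for which graph. -/
abbrev GraphTask := ∀ n : ℕ, SimpleGraph (Fin n) → (ℕ → ℕ) → Prop

/-- There is a word-RAM algorithm (with `O(log n)`-bit words) that performs `task` on every
connected undirected unweighted graph with `n` vertices and at most `C · n` edges, given by any of
its edge lists, in time `T n`. -/
def SolvableOnSparse (C : ℕ) (task : GraphTask) (T : ℕ → ℝ) : Prop :=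
  ∃ (p : Prog) (c : ℕ), ∀ (n : ℕ) (G : SimpleGraph (Fin n)) (L : List (Fin n × Fin n)),
    G.Connected → IsEdgeList G L → L.length ≤ C * n →
      RunsWithin p (wordSize c n) (graphInput L) (T n) (task n G)

/-- For every vertex `v`, memory cell `v` tells whether the eccentricity of `v` is at most `lo`
(cell `v` is zero) or at least `hi` (cell `v` is nonzero). Nothing is asked in between. -/
def eccGap (lo hi : ℕ) : GraphTask := fun n G out =>
  ∀ v : Fin n, (G.eccent v ≤ (lo : ℕ∞) → out v = 0) ∧ ((hi : ℕ∞) ≤ G.eccent v → out v ≠ 0)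

/-- For every vertex `v`, memory cell `v` is a `ρ`-approximation from above of the eccentricity of
`v`: at least the eccentricity, and at most `ρ` times the eccentricity. (The eccentricities of a
finite connected graph are finite.) -/
def eccApproxAbove (ρ : ℝ) : GraphTask := fun n G out =>
  ∀ v : Fin n, (((G.eccent v).toNat : ℕ) : ℝ) ≤ out v ∧ (out v : ℝ) ≤ ρ * ((G.eccent v).toNat : ℕ)

/-- For every vertex `v`, memory cell `v` is a `ρ`-approximation from below of the eccentricity of
`v`: at most the eccentricity, which is at most `ρ` times the cell. -/
def eccApproxBelow (ρ : ℝ) : GraphTask := fun n G out =>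
  ∀ v : Fin n, (out v : ℝ) ≤ ((G.eccent v).toNat : ℕ) ∧ (((G.eccent v).toNat : ℕ) : ℝ) ≤ ρ * out v

/-!
Let `K = k - 1`. Each of the `K + 1` collections is extended by the all-ones vector, as vector
number `0`, and all vectors by `K + 1` coordinates: of the added coordinates, the vectors of
collection `p` vanish at number `p` only. This changes nothing for orthogonal tuples and yields, for
every choice of vectors one of which is an all-ones vector, a coordinate at which none vanishes.

The layered graph has `3 K + 2` layers, with `O(n ^ K)` vertices each up to a power of `d`. A vertex
of the middle layers carries vectors of some of the collections and `K` coordinates at which these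
vectors do not vanish; from layer to layer, one vector is replaced by one of another collection, and
a coordinate is chosen anew. The sources, in layer `K`, are the tuples of vectors of the collections
`1, …, K`, and are joined to a hub by paths of length `K`; on the far side, pendant paths end in
the tuples of vectors of the collections `0, …, K - 1`. If no tuple is orthogonal, then common
coordinates connect any two tuples, and the sources have eccentricity at most `2 K + 1 = 2 k - 1`. A
walk of length at most `4 K` from the source of an orthogonal tuple to the end of the matching
pendant path would avoid the hub, and would be too short to replace all vectors and change all
coordinates: some of its coordinates would stay fixed and witness that the tuple is not orthogonal.
So this source has eccentricity at least `4 K + 1 = 4 k - 3`.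

An algorithm for eccentricities then gives one for orthogonal vectors: write the graph in memory
behind the instance, run the algorithm with its addresses shifted past the instance, and compare the
outputs at the sources with a threshold.
-/

namespace WordRAM

/-! ### Relocating a program -/

theorem forall_update_lt {b : ℕ} {f : ℕ → ℕ} (hf : ∀ a, f a < b) (r : ℕ) {x : ℕ} (hx : x < b) :
    ∀ a, Function.update f r x a < b := by
  intro a
  rcases eq_or_ne a r with rfl | h
  · simpa using hx
  · simpa [h] using hf a

theorem Exec.reg_lt {w t : ℕ} {p : Prog} {s s' : State} (h : Exec w p s t s') :
    (∀ r, s.reg r < 2 ^ w) → ∀ r, s'.reg r < 2 ^ w := by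
  induction h with
  | const _ r _ hv => exact fun hs => forall_update_lt hs r hv
  | op _ _ r _ _ hv => exact fun hs => forall_update_lt hs r hv
  | load _ r _ hv => exact fun hs => forall_update_lt hs r hv
  | seq _ _ ihp ihq => exact ihq ∘ ihp
  | ite_true _ _ ih | ite_false _ _ ih => exact ih
  | loop_step _ _ _ ihp ihl => exact ihl ∘ ihp
  | skip | store | loop_done => exact id

theorem Exec.mem_lt {w t b : ℕ} (hb : 2 ^ w ≤ b) {p : Prog} {s s' : State}
    (h : Exec w p s t s') :
    (∀ r, s.reg r < 2 ^ w) → (∀ a, s.mem a < b) → ∀ a, s'.mem a < b := by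
  induction h with
  | store _ a c => exact fun hr hm => forall_update_lt hm _ ((hr c).trans_le hb)
  | seq hp _ ihp ihq => exact fun hr hm => ihq (hp.reg_lt hr) (ihp hr hm)
  | ite_true _ _ ih | ite_false _ _ ih => exact ih
  | loop_step _ hp _ ihp ihl => exact fun hr hm => ihl (hp.reg_lt hr) (ihp hr hm)
  | _ => exact fun _ hm => hm

/-- A strict upper bound for the registers that occur in a program. -/
def Prog.regBound : Prog → ℕ
  | .skip => 0
  | .const r _ => r + 1
  | .op _ r a b => max (r + 1) (max (a + 1) (b + 1))
  | .load r a => max (r + 1) (a + 1)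
  | .store a b => max (a + 1) (b + 1)
  | .seq p q => max p.regBound q.regBound
  | .ite r p q => max (r + 1) (max p.regBound q.regBound)
  | .loop r p => max (r + 1) p.regBound

/-- The program with all its memory addresses shifted by the contents of the register `base`; the
shifted addresses are computed in the register `tmp`. -/
def Prog.relocate (base tmp : ℕ) : Prog → Prog
  | .load r a => .seq (.op .add tmp a base) (.load r tmp)
  | .store a b => .seq (.op .add tmp a base) (.store tmp b)
  | .seq p q => .seq (p.relocate base tmp) (q.relocate base tmp)
  | .ite r p q => .ite r (p.relocate base tmp) (q.relocate base tmp)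
  | .loop r p => .loop r (p.relocate base tmp)
  | .skip => .skip
  | .const r v => .const r v
  | .op o r a b => .op o r a b

/-- The configuration `u` represents `s` on the registers below `R` and on the memory from address
`b` on; apart from these and from the register `tmp` it agrees with `v`. -/
structure Represents (R tmp b : ℕ) (v s u : State) : Prop where
  reg_eq : ∀ r < R, u.reg r = s.reg r
  reg_frame : ∀ r, R ≤ r → r ≠ tmp → u.reg r = v.reg r
  mem_eq : ∀ a, u.mem (b + a) = s.mem a
  mem_frame : ∀ a < b, u.mem a = v.mem a

namespace Represents

variable {R tmp b : ℕ} {v s u : State}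

theorem update_tmp (h : Represents R tmp b v s u) (htmp : R ≤ tmp) (x : ℕ) :
    Represents R tmp b v s { u with reg := Function.update u.reg tmp x } where
  reg_eq r hr := by simpa [Function.update_of_ne (show r ≠ tmp by omega)] using h.reg_eq r hr
  reg_frame r hr hne := by simpa [Function.update_of_ne hne] using h.reg_frame r hr hne
  mem_eq := h.mem_eq
  mem_frame := h.mem_frame

theorem update_reg (h : Represents R tmp b v s u) {r : ℕ} (hr : r < R) (x : ℕ) :
    Represents R tmp b v { s with reg := Function.update s.reg r x }
      { u with reg := Function.update u.reg r x } where
  reg_eq q hq := by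
    rcases eq_or_ne q r with rfl | hqr
    · simp
    · simpa [Function.update_of_ne hqr] using h.reg_eq q hq
  reg_frame q hq hne := by
    simpa [Function.update_of_ne (show q ≠ r by omega)] using h.reg_frame q hq hne
  mem_eq := h.mem_eq
  mem_frame := h.mem_frame

theorem update_mem (h : Represents R tmp b v s u) (a x : ℕ) :
    Represents R tmp b v { s with mem := Function.update s.mem a x }
      { u with mem := Function.update u.mem (b + a) x } where
  reg_eq := h.reg_eq
  reg_frame := h.reg_frame
  mem_eq c := by
    rcases eq_or_ne c a with rfl | hc
    · simp
    · simpa [Function.update_of_ne hc, Function.update_of_ne (show b + c ≠ b + a by omega)]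
        using h.mem_eq c
  mem_frame c hc := by
    simpa [Function.update_of_ne (show c ≠ b + a by omega)] using h.mem_frame c hc

theorem exec_address {w base a : ℕ} (h : Represents R tmp b v s u) (hbase : R ≤ base)
    (hne : base ≠ tmp) (hv : v.reg base = b) (ha : a < R) (hlt : b + s.reg a < 2 ^ w) :
    Exec w (.op .add tmp a base) u 1
      { u with reg := Function.update u.reg tmp (b + s.reg a) } := by
  have heval : BinOp.add.eval (u.reg a) (u.reg base) = b + s.reg a := by
    rw [h.reg_eq a ha, h.reg_frame base hbase hne, hv, BinOp.eval, add_comm]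
  simpa only [heval] using Exec.op u .add tmp a base (heval ▸ hlt)

theorem exec_load {w base a r : ℕ} (h : Represents R tmp b v s u) (hbase : R ≤ base)
    (htmp : R ≤ tmp) (hne : base ≠ tmp) (hv : v.reg base = b) (hr : r < R) (ha : a < R)
    (haddr : b + s.reg a < 2 ^ w) (hval : s.mem (s.reg a) < 2 ^ w) :
    ∃ u', Exec w ((Prog.load r a).relocate base tmp) u 2 u' ∧
      Represents R tmp b v { s with reg := Function.update s.reg r (s.mem (s.reg a)) } u' := by
  have htmp' := h.update_tmp htmp (b + s.reg a)
  have hcell : u.mem (Function.update u.reg tmp (b + s.reg a) tmp) = s.mem (s.reg a) := by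
    rw [Function.update_self, h.mem_eq]
  exact ⟨_, .seq (h.exec_address hbase hne hv ha haddr)
    (.load _ r tmp (by simpa only [hcell] using hval)),
    by simpa only [hcell] using htmp'.update_reg hr _⟩

theorem exec_store {w base a c : ℕ} (h : Represents R tmp b v s u) (hbase : R ≤ base)
    (htmp : R ≤ tmp) (hne : base ≠ tmp) (hv : v.reg base = b) (ha : a < R) (hc : c < R)
    (haddr : b + s.reg a < 2 ^ w) :
    ∃ u', Exec w ((Prog.store a c).relocate base tmp) u 2 u' ∧
      Represents R tmp b v { s with mem := Function.update s.mem (s.reg a) (s.reg c) } u' := by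
  have htmp' := h.update_tmp htmp (b + s.reg a)
  refine ⟨_, .seq (h.exec_address hbase hne hv ha haddr) (.store _ tmp c), ?_⟩
  have hreg : Function.update u.reg tmp (b + s.reg a) c = s.reg c := htmp'.reg_eq c hc
  simpa only [Function.update_self, hreg] using htmp'.update_mem (s.reg a) (s.reg c)

end Represents

theorem Exec.relocate {w w' R base tmp b : ℕ} (hw : 2 ^ w + b ≤ 2 ^ w') (hbase : R ≤ base)
    (htmp : R ≤ tmp) (hne : base ≠ tmp) {v : State} (hv : v.reg base = b) {p : Prog}
    {s s' : State} {t : ℕ} (h : Exec w p s t s') :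
    p.regBound ≤ R → (∀ r, s.reg r < 2 ^ w) → ∀ u, Represents R tmp b v s u →
      ∃ t' u', Exec w' (p.relocate base tmp) u t' u' ∧ t' ≤ 2 * t ∧
        Represents R tmp b v s' u' := by
  have hpos : 0 < 2 ^ w := by positivity
  induction h <;> intro hR hs u hu <;> simp only [Prog.regBound, max_le_iff] at hR
  case skip => exact ⟨1, u, .skip u, by omega, hu⟩
  case const r x hx =>
    exact ⟨1, _, .const u r x (by omega), by omega, hu.update_reg (by omega) x⟩
  case op o r a c hx =>
    have ha := hu.reg_eq a (by omega)
    have hc := hu.reg_eq c (by omega)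
    exact ⟨1, _, .op u o r a c (by rw [ha, hc]; omega), by omega,
      by simpa only [ha, hc] using hu.update_reg (by omega) _⟩
  case load s r a hx =>
    have := hs a
    obtain ⟨u', hu', hrep⟩ := hu.exec_load (w := w') hbase htmp hne hv (r := r) (a := a)
      (by omega) (by omega) (by omega) (by omega)
    exact ⟨2, u', hu', le_rfl, hrep⟩
  case store s a c =>
    have := hs a
    obtain ⟨u', hu', hrep⟩ := hu.exec_store (w := w') hbase htmp hne hv (a := a) (c := c)
      (by omega) (by omega) (by omega)
    exact ⟨2, u', hu', le_rfl, hrep⟩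
  case seq hp _ ihp ihq =>
    obtain ⟨t₁, u₁, h₁, ht₁, hu₁⟩ := ihp hR.1 hs u hu
    obtain ⟨t₂, u₂, h₂, ht₂, hu₂⟩ := ihq hR.2 (hp.reg_lt hs) u₁ hu₁
    exact ⟨t₁ + t₂, u₂, .seq h₁ h₂, by omega, hu₂⟩
  case ite_true hr _ ih =>
    obtain ⟨t₁, u₁, h₁, ht₁, hu₁⟩ := ih hR.2.1 hs u hu
    exact ⟨t₁ + 1, u₁, .ite_true (by rwa [hu.reg_eq _ (by omega)]) h₁, by omega, hu₁⟩
  case ite_false hr _ ih =>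
    obtain ⟨t₁, u₁, h₁, ht₁, hu₁⟩ := ih hR.2.2 hs u hu
    exact ⟨t₁ + 1, u₁, .ite_false (by rwa [hu.reg_eq _ (by omega)]) h₁, by omega, hu₁⟩
  case loop_done hr =>
    exact ⟨1, u, .loop_done (by rwa [hu.reg_eq _ (by omega)]), by omega, hu⟩
  case loop_step hr hp _ ihp ihl =>
    obtain ⟨t₁, u₁, h₁, ht₁, hu₁⟩ := ihp hR.2 hs u hu
    obtain ⟨t₂, u₂, h₂, ht₂, hu₂⟩ :=
      ihl (by simpa only [Prog.regBound, max_le_iff] using hR) (hp.reg_lt hs) u₁ hu₁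
    exact ⟨t₁ + t₂ + 1, u₂, .loop_step (by rwa [hu.reg_eq _ (by omega)]) h₁ h₂, by omega, hu₂⟩

/-! ### Total correctness with time bounds -/

/-- Total correctness: started in `u`, the program `p` halts after at most `T` steps in a
configuration that satisfies `Q`. -/
def Halts (w : ℕ) (p : Prog) (T : ℕ) (u : State) (Q : State → Prop) : Prop :=
  ∃ k ≤ T, ∃ u', Exec w p u k u' ∧ Q u'

namespace Halts

variable {w T U m : ℕ} {p q : Prog} {u : State} {Q Q' : State → Prop}

theorem mono (h : Halts w p T u Q) (hT : T ≤ U) (hQ : ∀ u', Q u' → Q' u') : Halts w p U u Q' := by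
  obtain ⟨k, hk, u', hu', hq⟩ := h
  exact ⟨k, hk.trans hT, u', hu', hQ u' hq⟩

theorem seq (hp : Halts w p T u Q) (hq : ∀ u', Q u' → Halts w q U u' Q') :
    Halts w (.seq p q) (T + U) u Q' := by
  obtain ⟨k, hk, u₁, h₁, hu₁⟩ := hp
  obtain ⟨l, hl, u₂, h₂, hu₂⟩ := hq u₁ hu₁
  exact ⟨k + l, by omega, u₂, .seq h₁ h₂, hu₂⟩

theorem ite {r : ℕ} (hp : u.reg r ≠ 0 → Halts w p T u Q) (hq : u.reg r = 0 → Halts w q T u Q) :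
    Halts w (.ite r p q) (T + 1) u Q := by
  by_cases hr : u.reg r = 0
  · obtain ⟨k, hk, u', h, hu'⟩ := hq hr
    exact ⟨k + 1, by omega, u', .ite_false hr h, hu'⟩
  · obtain ⟨k, hk, u', h, hu'⟩ := hp hr
    exact ⟨k + 1, by omega, u', .ite_true hr h, hu'⟩

theorem skip (h : Q u) : Halts w .skip 1 u Q := ⟨1, le_rfl, u, .skip u, h⟩

theorem const {r v : ℕ} (hv : v < 2 ^ w)
    (h : Q { u with reg := Function.update u.reg r v }) : Halts w (.const r v) 1 u Q :=
  ⟨1, le_rfl, _, .const u r v hv, h⟩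

theorem op {o : BinOp} {r a b v : ℕ} (hv : o.eval (u.reg a) (u.reg b) = v) (hlt : v < 2 ^ w)
    (h : Q { u with reg := Function.update u.reg r v }) : Halts w (.op o r a b) 1 u Q := by
  subst hv
  exact ⟨1, le_rfl, _, .op u o r a b hlt, h⟩

theorem load {r a v : ℕ} (hv : u.mem (u.reg a) = v) (hlt : v < 2 ^ w)
    (h : Q { u with reg := Function.update u.reg r v }) : Halts w (.load r a) 1 u Q := by
  subst hv
  exact ⟨1, le_rfl, _, .load u r a hlt, h⟩

theorem store {a b : ℕ} (h : Q { u with mem := Function.update u.mem (u.reg a) (u.reg b) }) :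
    Halts w (.store a b) 1 u Q :=
  ⟨1, le_rfl, _, .store u a b, h⟩

theorem loop {r : ℕ} (J : ℕ → State → Prop)
    (hstep : ∀ i < m, ∀ u, J i u → u.reg r ≠ 0 ∧ Halts w p T u (J (i + 1)))
    (hdone : ∀ u, J m u → u.reg r = 0) (h : J 0 u) :
    Halts w (.loop r p) (m * (T + 1) + 1) u (J m) := by
  have from_iteration : ∀ j i, i + j = m → ∀ u, J i u →
      Halts w (.loop r p) (j * (T + 1) + 1) u (J m) := by
    intro j
    induction j with
    | zero =>
      rintro i rfl u hu
      exact ⟨1, by omega, u, .loop_done (hdone u hu), hu⟩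
    | succ j ih =>
      intro i hi u hu
      obtain ⟨hr, k, hk, u₁, h₁, hu₁⟩ := hstep i (by omega) u hu
      obtain ⟨l, hl, u₂, h₂, hu₂⟩ := ih (i + 1) (by omega) u₁ hu₁
      exact ⟨k + l + 1, by rw [Nat.succ_mul]; omega, u₂, .loop_step hr h₁ h₂, hu₂⟩
  exact from_iteration m 0 (zero_add m) u h

end Halts

/-! ### Arithmetic expressions -/

/-- The operations used in expressions: those that are bounded by a product of bounds `≥ 2` for
their arguments. -/
inductive ArithOp
  | add | sub | mul | div | mod | lt | eq

/-- The machine instruction for an operation. -/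
def ArithOp.toBinOp : ArithOp → BinOp
  | .add => .add
  | .sub => .sub
  | .mul => .mul
  | .div => .div
  | .mod => .mod
  | .lt => .lt
  | .eq => .eq

theorem ArithOp.eval_le {B x y a b : ℕ} (o : ArithOp) (hB : 2 ≤ B) (ha : 1 ≤ a) (hb : 1 ≤ b)
    (hx : x ≤ B ^ a) (hy : y ≤ B ^ b) : o.toBinOp.eval x y ≤ B ^ (a + b) := by
  have ha₂ : 2 ≤ B ^ a := hB.trans (Nat.le_self_pow (by omega) B)
  have hb₂ : 2 ≤ B ^ b := hB.trans (Nat.le_self_pow (by omega) B)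
  have hab : B ^ a ≤ B ^ a * B ^ b := Nat.le_mul_of_pos_right _ (by omega)
  rw [pow_add]
  cases o <;> simp only [toBinOp, BinOp.eval]
  case add => nlinarith
  case sub => omega
  case mul => exact Nat.mul_le_mul hx hy
  case div => exact (Nat.div_le_self _ _).trans (hx.trans hab)
  case mod => exact (Nat.mod_le _ _).trans (hx.trans hab)
  all_goals split_ifs <;> omega

/-- Arithmetic expressions over the registers (`var`) and the memory (`get`). -/
inductive Expr
  | var (r : ℕ)
  | num (v : ℕ)
  | op (o : ArithOp) (a b : Expr)
  | get (a : Expr)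

namespace Expr

instance : Add Expr := ⟨op .add⟩
instance : Sub Expr := ⟨op .sub⟩
instance : Mul Expr := ⟨op .mul⟩
instance : Div Expr := ⟨op .div⟩
instance : Mod Expr := ⟨op .mod⟩
instance (v : ℕ) : OfNat Expr v := ⟨num v⟩

/-- The value of an expression. -/
def eval (s : State) : Expr → ℕ
  | var r => s.reg r
  | num v => v
  | op o a b => o.toBinOp.eval (a.eval s) (b.eval s)
  | get a => s.mem (a.eval s)

/-- The size of an expression; numerals count in unary, so that the size controls the values. -/
def size : Expr → ℕ
  | var _ => 1
  | num v => v + 1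
  | op _ a b => a.size + b.size
  | get a => a.size

/-- The number of instructions of the compiled expression. -/
def steps : Expr → ℕ
  | var _ => 1
  | num _ => 1
  | op _ a b => a.steps + (b.steps + 1)
  | get a => a.steps + 1

/-- A strict upper bound for the registers that occur in an expression. -/
def varBound : Expr → ℕ
  | var r => r + 1
  | num _ => 0
  | op _ a b => max a.varBound b.varBound
  | get a => a.varBound

/-- The program that computes the value of an expression in register `t`, with the registers
above `t` as scratch space. -/
def compile : Expr → ℕ → Prog
  | var r, t => .op .lor t r r
  | num v, t => .const t v
  | op o a b, t => .seq (a.compile t) (.seq (b.compile (t + 1)) (.op o.toBinOp t t (t + 1)))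
  | get a, t => .seq (a.compile t) (.load t t)

section eval

variable (s : State) (a b : Expr)

@[simp] theorem eval_var (r : ℕ) : (var r).eval s = s.reg r := rfl
@[simp] theorem eval_num (v : ℕ) : (num v).eval s = v := rfl
@[simp] theorem eval_ofNat (v : ℕ) : (ofNat(v) : Expr).eval s = v := rfl
@[simp] theorem eval_get : (get a).eval s = s.mem (a.eval s) := rfl
@[simp] theorem eval_add : (a + b).eval s = a.eval s + b.eval s := rfl
@[simp] theorem eval_sub : (a - b).eval s = a.eval s - b.eval s := rfl
@[simp] theorem eval_mul : (a * b).eval s = a.eval s * b.eval s := rfl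
@[simp] theorem eval_div : (a / b).eval s = a.eval s / b.eval s := rfl
@[simp] theorem eval_mod : (a % b).eval s = a.eval s % b.eval s := rfl

@[simp] theorem eval_lt :
    (op .lt a b).eval s = if a.eval s < b.eval s then 1 else 0 := rfl

@[simp] theorem eval_eq :
    (op .eq a b).eval s = if a.eval s = b.eval s then 1 else 0 := rfl

end eval

theorem one_le_size (e : Expr) : 1 ≤ e.size := by
  induction e <;> simp only [size] <;> omega

end Expr

/-- The machine configuration `u` agrees with the configuration `s` of a structured program, which
uses the registers below `t` and words up to `B`. -/
structure Models (t B : ℕ) (s u : State) : Prop where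
  reg_eq : ∀ r < t, u.reg r = s.reg r
  mem_eq : u.mem = s.mem
  reg_le : ∀ r < t, s.reg r ≤ B
  mem_le : ∀ a, s.mem a ≤ B

theorem Models.congr {t B : ℕ} {s u u' : State} (h : Models t B s u)
    (hreg : ∀ r < t, u'.reg r = u.reg r) (hmem : u'.mem = u.mem) : Models t B s u' where
  reg_eq r hr := (hreg r hr).trans (h.reg_eq r hr)
  mem_eq := hmem.trans h.mem_eq
  reg_le := h.reg_le
  mem_le := h.mem_le

theorem Expr.eval_le {B t : ℕ} {s u : State} (hs : Models t B s u) (hB : 2 ≤ B) (e : Expr)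
    (ht : e.varBound ≤ t) : e.eval s ≤ B ^ e.size := by
  induction e with
  | var r => simpa [size] using hs.reg_le r (by simpa [varBound] using ht)
  | num v =>
    exact (Nat.lt_pow_self (by omega)).le.trans (Nat.pow_le_pow_right (by omega) (Nat.le_succ v))
  | op o a b iha ihb =>
    simp only [varBound, max_le_iff] at ht
    exact o.eval_le hB a.one_le_size b.one_le_size (iha ht.1) (ihb ht.2)
  | get a =>
    have hsize : a.size ≠ 0 := Nat.one_le_iff_ne_zero.1 a.one_le_size
    exact (hs.mem_le _).trans (Nat.le_self_pow hsize B)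

theorem Expr.halts_compile {B w t₀ m : ℕ} {s : State} (hB : 2 ≤ B) (hw : B ^ m < 2 ^ w)
    (e : Expr) : e.varBound ≤ t₀ → e.size ≤ m → ∀ t ≥ t₀, ∀ u, Models t₀ B s u →
      Halts w (e.compile t) e.steps u fun u' =>
        u'.reg t = e.eval s ∧ (∀ r < t, u'.reg r = u.reg r) ∧ u'.mem = u.mem := by
  have frame (u : State) (t v : ℕ) : ∀ r < t, Function.update u.reg t v r = u.reg r :=
    fun r hr => Function.update_of_ne (by omega) _ _
  have fits (e : Expr) (hv : e.varBound ≤ t₀) (hm : e.size ≤ m) {u : State}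
      (hu : Models t₀ B s u) : e.eval s < 2 ^ w :=
    ((e.eval_le hu hB hv).trans (Nat.pow_le_pow_right (by omega) hm)).trans_lt hw
  induction e with
  | var r =>
    intro hv hm t _ u hu
    refine .op ?_ (fits _ hv hm hu) ⟨Function.update_self .., frame u t _, rfl⟩
    rw [hu.reg_eq r hv]
    exact Nat.or_self _
  | num v =>
    intro hv hm t _ u hu
    exact .const (fits _ hv hm hu) ⟨Function.update_self .., frame u t _, rfl⟩
  | op o a b iha ihb =>
    intro hv hm t ht u hu
    have ⟨hva, hvb⟩ := max_le_iff.1 hv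
    have hab : a.size + b.size ≤ m := hm
    refine (iha hva (by omega) t ht u hu).seq fun u₁ ⟨hval₁, hreg₁, hmem₁⟩ => ?_
    refine (ihb hvb (by omega) (t + 1) (by omega) u₁
      (hu.congr (fun r hr => hreg₁ r (by omega)) hmem₁)).seq fun u₂ ⟨hval₂, hreg₂, hmem₂⟩ => ?_
    refine .op (by rw [hreg₂ t (by omega), hval₁, hval₂]; rfl) (fits _ hv hm hu)
      ⟨Function.update_self .., fun r hr => ?_, hmem₂.trans hmem₁⟩
    exact (frame u₂ t _ r hr).trans ((hreg₂ r (by omega)).trans (hreg₁ r hr))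
  | get a ih =>
    intro hv hm t ht u hu
    refine (ih hv hm t ht u hu).seq fun u₁ ⟨hval₁, hreg₁, hmem₁⟩ => ?_
    refine .load (by rw [hval₁, hmem₁, hu.mem_eq]; rfl) (fits _ hv hm hu)
      ⟨Function.update_self .., fun r hr => ?_, hmem₁⟩
    exact (frame u₁ t _ r hr).trans (hreg₁ r hr)

/-! ### Structured programs -/

/-- The configuration with register `r` changed to `v`. -/
def State.setReg (s : State) (r v : ℕ) : State := { s with reg := Function.update s.reg r v }

/-- The configuration with memory cell `a` changed to `v`. -/
def State.setMem (s : State) (a v : ℕ) : State := { s with mem := Function.update s.mem a v }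

/-- Structured programs over expressions. In `loop r e c` the bound `e` is evaluated once, before
the first iteration, and `r` takes the values `0, 1, …` below it. -/
inductive Cmd
  | skip
  | assign (r : ℕ) (e : Expr)
  | write (a e : Expr)
  | seq (c d : Cmd)
  | when (e : Expr) (c : Cmd)
  | loop (r : ℕ) (e : Expr) (c : Cmd)

namespace Cmd

/-- The machine program of a structured program, with the registers from `t` on as scratch space.
A loop keeps its bound in `t`, its counter in `t + 1` and its test in `t + 2`. -/
def compile : Cmd → ℕ → Prog
  | skip, _ => .skip
  | assign r e, t => .seq (e.compile t) (.op .lor r t t)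
  | write a e, t => .seq (a.compile t) (.seq (e.compile (t + 1)) (.store t (t + 1)))
  | seq c d, t => .seq (c.compile t) (d.compile t)
  | when e c, t => .seq (e.compile t) (.ite t (c.compile t) .skip)
  | loop r e c, t =>
    .seq (e.compile t) (.seq (.const (t + 1) 0) (.seq (.op .lt (t + 2) (t + 1) t)
      (.loop (t + 2) (.seq (.op .lor r (t + 1) (t + 1)) (.seq (c.compile (t + 3))
        (.seq (.const (t + 2) 1) (.seq (.op .add (t + 1) (t + 1) (t + 2))
          (.op .lt (t + 2) (t + 1) t))))))))

/-- A strict upper bound for the registers that occur in a structured program. -/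
def regBound : Cmd → ℕ
  | skip => 0
  | assign r e => max (r + 1) e.varBound
  | write a e => max a.varBound e.varBound
  | seq c d => max c.regBound d.regBound
  | when e c => max e.varBound c.regBound
  | loop r e c => max (r + 1) (max e.varBound c.regBound)

/-- The maximal size of an expression in a structured program. -/
def exprSize : Cmd → ℕ
  | skip => 0
  | assign _ e => e.size
  | write a e => max a.size e.size
  | seq c d => max c.exprSize d.exprSize
  | when e c => max e.size c.exprSize
  | loop _ e c => max e.size c.exprSize

/-- A bound for the running time of the compiled program if no loop has more than `N`
iterations. -/
def cost (N : ℕ) : Cmd → ℕ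
  | skip => 1
  | assign _ e => e.steps + 1
  | write a e => a.steps + (e.steps + 1)
  | seq c d => c.cost N + d.cost N
  | when e c => e.steps + (c.cost N + 1 + 1)
  | loop _ e c => e.steps + (1 + (1 + (N * (c.cost N + 4 + 1) + 1)))

/-- The nesting depth of the loops. -/
def depth : Cmd → ℕ
  | skip => 0
  | assign _ _ => 0
  | write _ _ => 0
  | seq c d => max c.depth d.depth
  | when _ c => c.depth
  | loop _ _ c => c.depth + 1

/-- A precondition for `Q` to hold at the end of a structured program, with words up to `B` and at
most `N` iterations of every loop. -/
def wp (B N : ℕ) : Cmd → (State → Prop) → State → Prop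
  | skip, Q, s => Q s
  | assign r e, Q, s => e.eval s ≤ B ∧ Q (s.setReg r (e.eval s))
  | write a e, Q, s => e.eval s ≤ B ∧ Q (s.setMem (a.eval s) (e.eval s))
  | seq c d, Q, s => c.wp B N (d.wp B N Q) s
  | when e c, Q, s => (e.eval s ≠ 0 → c.wp B N Q s) ∧ (e.eval s = 0 → Q s)
  | loop r e c, Q, s => e.eval s ≤ N ∧ ∃ I : ℕ → State → Prop, I 0 s ∧
      (∀ i < e.eval s, ∀ s', I i s' → c.wp B N (I (i + 1)) (s'.setReg r i)) ∧
      ∀ s', I (e.eval s) s' → Q s'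

theorem cost_le {N : ℕ} (hN : 1 ≤ N) (c : Cmd) : c.cost N ≤ c.cost 1 * N ^ c.depth := by
  have weaken {x y a b : ℕ} (h : x ≤ y * N ^ a) (hab : a ≤ b) : x ≤ y * N ^ b :=
    h.trans (Nat.mul_le_mul_left _ (Nat.pow_le_pow_right hN hab))
  have one_le (a : ℕ) : 1 ≤ N ^ a := Nat.one_le_pow _ _ hN
  induction c with
  | skip | assign | write => simp [cost, depth]
  | seq c d ihc ihd =>
    have hc := weaken ihc (le_max_left c.depth d.depth)
    have hd := weaken ihd (le_max_right c.depth d.depth)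
    simp only [cost, depth, add_mul]
    omega
  | when e c ih =>
    simp only [cost, depth] at ih ⊢
    nlinarith [one_le c.depth]
  | loop r e c ih =>
    simp only [cost, depth, pow_succ] at ih ⊢
    nlinarith [one_le c.depth, Nat.mul_le_mul_right N ih, Nat.mul_le_mul (one_le c.depth) hN]

end Cmd

theorem Models.setReg {t B : ℕ} {s u u' : State} (h : Models t B s u) {r v : ℕ} (hv : v ≤ B)
    (hr : u'.reg r = v) (hreg : ∀ q < t, q ≠ r → u'.reg q = u.reg q) (hmem : u'.mem = u.mem) :
    Models t B (s.setReg r v) u' where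
  reg_eq q hq := by
    rcases eq_or_ne q r with rfl | hqr
    · simpa [State.setReg] using hr
    · simpa [State.setReg, hqr] using (hreg q hq hqr).trans (h.reg_eq q hq)
  mem_eq := hmem.trans h.mem_eq
  reg_le q hq := by
    rcases eq_or_ne q r with rfl | hqr
    · simpa [State.setReg] using hv
    · simpa [State.setReg, hqr] using h.reg_le q hq
  mem_le := h.mem_le

theorem Models.setMem {t B : ℕ} {s u u' : State} (h : Models t B s u) {a v : ℕ} (hv : v ≤ B)
    (hreg : ∀ q < t, u'.reg q = u.reg q) (hmem : u'.mem = Function.update u.mem a v) :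
    Models t B (s.setMem a v) u' where
  reg_eq q hq := (hreg q hq).trans (h.reg_eq q hq)
  mem_eq := by rw [hmem, h.mem_eq]; rfl
  reg_le := h.reg_le
  mem_le c := by
    rcases eq_or_ne c a with rfl | hca
    · simpa [State.setMem] using hv
    · simpa [State.setMem, hca] using h.mem_le c

namespace Cmd

/-- The postcondition of a compiled structured program that uses the registers below `t₀` and is
started in `u`: some configuration in `Q` is modelled, and the registers between `t₀` and `t`,
which hold the loop variables of the context, are unchanged. -/
def Post (t₀ t B : ℕ) (Q : State → Prop) (u u' : State) : Prop :=
  (∃ s, Q s ∧ Models t₀ B s u') ∧ ∀ r, t₀ ≤ r → r < t → u'.reg r = u.reg r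

/-- The compiled program, started in a configuration that models a state with the precondition
`c.wp B N Q`, terminates in time `c.cost N` and establishes `Q`. -/
def Sound (w t₀ B N : ℕ) (c : Cmd) : Prop :=
  ∀ t ≥ t₀, ∀ (Q : State → Prop) (s u : State), Models t₀ B s u → c.wp B N Q s →
    Halts w (c.compile t) (c.cost N) u (Post t₀ t B Q u)

variable {w t₀ B N : ℕ}

theorem sound_assign {m r : ℕ} {e : Expr} (hB : 2 ≤ B) (hw : B ^ m < 2 ^ w) (hBw : B < 2 ^ w)
    (hr : r < t₀) (he : e.varBound ≤ t₀) (hm : e.size ≤ m) :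
    Sound w t₀ B N (.assign r e) := by
  rintro t ht Q s u hu ⟨hle, hQ⟩
  refine (e.halts_compile hB hw he hm t ht u hu).seq fun u₁ ⟨hval, hreg, hmem⟩ => ?_
  refine .op (Nat.or_self _) (by omega) ⟨⟨_, hQ, hu.setReg hle ?_ ?_ hmem⟩, ?_⟩
  · simpa using hval
  · exact fun q hq hqr => (Function.update_of_ne hqr _ _).trans (hreg q (by omega))
  · exact fun q hq hqt => (Function.update_of_ne (by omega) _ _).trans (hreg q hqt)

theorem sound_write {m : ℕ} {a e : Expr} (hB : 2 ≤ B) (hw : B ^ m < 2 ^ w)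
    (ha : a.varBound ≤ t₀) (he : e.varBound ≤ t₀) (ham : a.size ≤ m) (hem : e.size ≤ m) :
    Sound w t₀ B N (.write a e) := by
  rintro t ht Q s u hu ⟨hle, hQ⟩
  refine (a.halts_compile hB hw ha ham t ht u hu).seq fun u₁ ⟨hval₁, hreg₁, hmem₁⟩ => ?_
  have hu₁ := hu.congr (fun r hr => hreg₁ r (by omega)) hmem₁
  refine (e.halts_compile hB hw he hem (t + 1) (by omega) u₁ hu₁).seq
    fun u₂ ⟨hval₂, hreg₂, hmem₂⟩ => ?_
  have hreg : ∀ r < t, u₂.reg r = u.reg r := fun r hr => (hreg₂ r (by omega)).trans (hreg₁ r hr)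
  refine .store ⟨⟨_, hQ, hu.setMem hle (fun r hr => hreg r (by omega)) ?_⟩, fun r _ => hreg r⟩
  rw [hreg₂ t (by omega), hval₁, hval₂, hmem₂, hmem₁]

theorem Sound.seq {c d : Cmd} (hc : Sound w t₀ B N c) (hd : Sound w t₀ B N d) :
    Sound w t₀ B N (.seq c d) := by
  intro t ht Q s u hu h
  refine (hc t ht _ s u hu h).seq fun u₁ ⟨⟨s₁, h₁, hu₁⟩, hreg₁⟩ => ?_
  exact (hd t ht Q s₁ u₁ hu₁ h₁).mono le_rfl fun u₂ ⟨hQ, hreg₂⟩ =>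
    ⟨hQ, fun r hr hrt => (hreg₂ r hr hrt).trans (hreg₁ r hr hrt)⟩

theorem Sound.when {m : ℕ} {e : Expr} {c : Cmd} (hc : Sound w t₀ B N c) (hB : 2 ≤ B)
    (hw : B ^ m < 2 ^ w) (he : e.varBound ≤ t₀) (hm : e.size ≤ m) :
    Sound w t₀ B N (.when e c) := by
  rintro t ht Q s u hu ⟨htrue, hfalse⟩
  refine (e.halts_compile hB hw he hm t ht u hu).seq fun u₁ ⟨hval, hreg, hmem⟩ => ?_
  have hu₁ := hu.congr (fun r hr => hreg r (by omega)) hmem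
  refine .ite (fun h => ?_) fun h => ?_
  · exact (hc t ht Q s u₁ hu₁ (htrue (by rwa [← hval]))).mono (by omega) fun u₂ ⟨hQ, hreg₂⟩ =>
      ⟨hQ, fun r hr hrt => (hreg₂ r hr hrt).trans (hreg r hrt)⟩
  · exact (Halts.skip ⟨⟨s, hfalse (by rwa [← hval]), hu₁⟩, fun r _ => hreg r⟩).mono (by omega)
      fun _ => id

/-- The configuration `u'` of the machine at the test of a compiled loop with `n` iterations that
was entered in the configuration `u`, when `i` iterations are completed and `I` holds. -/
structure AtTest (t₀ t B n : ℕ) (I : State → Prop) (u : State) (i : ℕ) (u' : State) : Prop where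
  inv : ∃ s, I s ∧ Models t₀ B s u'
  frame : ∀ q, t₀ ≤ q → q < t → u'.reg q = u.reg q
  bound : u'.reg t = n
  counter : u'.reg (t + 1) = i
  test : u'.reg (t + 2) = if i < n then 1 else 0

theorem Sound.iteration {r t i n : ℕ} {c : Cmd} {I I' : State → Prop} {u u' : State}
    (hc : Sound w t₀ B N c) (hBw : B + 1 < 2 ^ w) (hr : r < t₀) (ht : t₀ ≤ t) (hi : i < n)
    (hn : n ≤ B) (hI : ∀ s, I s → c.wp B N I' (s.setReg r i))
    (h : AtTest t₀ t B n I u i u') :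
    Halts w (.seq (.op .lor r (t + 1) (t + 1)) (.seq (c.compile (t + 3)) (.seq (.const (t + 2) 1)
      (.seq (.op .add (t + 1) (t + 1) (t + 2)) (.op .lt (t + 2) (t + 1) t)))))
      (1 + (c.cost N + (1 + (1 + 1)))) u' (AtTest t₀ t B n I' u (i + 1)) := by
  obtain ⟨⟨s, hs, hu'⟩, hframe, hbound, hcounter, -⟩ := h
  refine .seq (.op (v := i) (hcounter ▸ Nat.or_self _) (by omega) rfl) ?_
  rintro _ rfl
  have hu₁ := hu'.setReg (u' := { u' with reg := Function.update u'.reg r i }) (r := r)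
    (by omega) (Function.update_self ..) (fun q _ hqr => Function.update_of_ne hqr _ _) rfl
  refine (hc (t + 3) (by omega) _ _ _ hu₁ (hI s hs)).seq fun u₂ ⟨⟨s₂, hs₂, hu₂⟩, hreg₂⟩ => ?_
  refine .seq (.const (by omega) rfl) ?_
  rintro _ rfl
  refine .seq (.op (v := i + 1) ?_ (by omega) rfl) ?_
  · grind [BinOp.eval]
  rintro _ rfl
  refine .op (v := if i + 1 < n then 1 else 0) ?_ (by split_ifs <;> omega)
    ⟨⟨s₂, hs₂, hu₂.congr (fun q hq => ?_) rfl⟩, fun q hq hqt => ?_, ?_, ?_, ?_⟩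
  all_goals grind [BinOp.eval]

theorem Sound.loop {m r : ℕ} {e : Expr} {c : Cmd} (hc : Sound w t₀ B N c) (hB : 2 ≤ B)
    (hN : N ≤ B) (hw : B ^ m < 2 ^ w) (hBw : B + 1 < 2 ^ w) (hr : r < t₀)
    (he : e.varBound ≤ t₀) (hm : e.size ≤ m) : Sound w t₀ B N (.loop r e c) := by
  rintro t ht Q s u hu ⟨hle, I, hI₀, hIstep, hIdone⟩
  refine (e.halts_compile hB hw he hm t ht u hu).seq fun u₁ ⟨hval, hreg, hmem⟩ => ?_
  refine .seq (.const (by omega) rfl) ?_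
  rintro _ rfl
  refine .seq (.op (v := if 0 < e.eval s then 1 else 0) ?_ (by split_ifs <;> omega) rfl) ?_
  · simp [BinOp.eval, hval]
  rintro _ rfl
  refine Halts.mono (Halts.loop (fun i => AtTest t₀ t B (e.eval s) (I i) u i)
    (fun i hi u' hu' => ⟨by simp [hu'.test, hi],
      hc.iteration hBw hr ht hi (hle.trans hN) (hIstep i hi) hu'⟩)
    (fun u' hu' => by simp [hu'.test])
    ⟨⟨s, hI₀, hu.congr (fun q hq => ?_) hmem⟩, fun q hq hqt => ?_, ?_, ?_, ?_⟩) ?_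
    fun u' hu' => ⟨hu'.inv.imp fun s' => .imp_left (hIdone s'), hu'.frame⟩
  case refine_6 =>
    rw [show 1 + (c.cost N + (1 + (1 + 1))) = c.cost N + 4 by omega]
    gcongr
  all_goals grind

theorem sound {m : ℕ} (hB : 2 ≤ B) (hN : N ≤ B) (hw : B ^ m < 2 ^ w) (hBw : B + 1 < 2 ^ w)
    (c : Cmd) : c.regBound ≤ t₀ → c.exprSize ≤ m → Sound w t₀ B N c := by
  induction c with
  | skip => exact fun _ _ t _ Q s u hu hQ => .skip ⟨⟨s, hQ, hu⟩, fun _ _ _ => rfl⟩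
  | assign r e =>
    exact fun ht hm => sound_assign hB hw (by omega) (le_of_max_le_left ht)
      (le_of_max_le_right ht) hm
  | write a e =>
    exact fun ht hm => sound_write hB hw (le_of_max_le_left ht) (le_of_max_le_right ht)
      (le_of_max_le_left hm) (le_of_max_le_right hm)
  | seq c d ihc ihd =>
    exact fun ht hm => (ihc (le_of_max_le_left ht) (le_of_max_le_left hm)).seq
      (ihd (le_of_max_le_right ht) (le_of_max_le_right hm))
  | when e c ih =>
    exact fun ht hm => (ih (le_of_max_le_right ht) (le_of_max_le_right hm)).when hB hw
      (le_of_max_le_left ht) (le_of_max_le_left hm)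
  | loop r e c ih =>
    exact fun ht hm => (ih (le_of_max_le_right (le_of_max_le_right ht))
      (le_of_max_le_right hm)).loop hB hN hw hBw (le_of_max_le_left ht)
      (le_of_max_le_left (le_of_max_le_right ht))
      (le_of_max_le_left hm)

end Cmd

end WordRAM

/-! ### The layered graph -/

namespace Layered

/-- The labels of the edges between two layers: `K` vector indices and `K` coordinates. -/
abbrev Label (K n d : ℕ) := (Fin K → Fin n) × (Fin K → Fin d)

/-- A vertex: its layer, and the part of the labels of its edges that all of them share, with the
other entries set to `0`. -/
abbrev Vertex (K n d : ℕ) := ℕ × Label K n d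

/-- The part of the edge label `z` that is visible in layer `l`: layer `0` sees nothing, the layers
`1, …, K` and `2K + 1, …` see the vectors, and layer `K + 1 + q` with `q < K` sees the coordinates
and all vectors but the one in position `q`. -/
def proj {K n d : ℕ} [NeZero n] [NeZero d] (l : ℕ) (z : Label K n d) : Label K n d :=
  (fun q => if l = 0 ∨ (q : ℕ) + K + 1 = l then 0 else z.1 q,
    if K < l ∧ l ≤ 2 * K then z.2 else 0)

/-- Position `q` holds a vector of collection `q` if `q < i` and one of collection `q + 1`
otherwise; this vector is `1` at the coordinates `m ≥ q` in the first and `m ≤ q` in the second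
case. -/
def Consistent {K n d : ℕ} (bit : ℕ → Fin n → Fin d → Prop) (i : ℕ) (z : Label K n d) : Prop :=
  ∀ q m : Fin K, ((q : ℕ) < i → q ≤ m → bit q (z.1 q) (z.2 m)) ∧
    (i ≤ q → m ≤ q → bit (q + 1) (z.1 q) (z.2 m))

variable {K n d : ℕ} [NeZero n] [NeZero d]

/-- There is an edge with label `z` between the layers `l` and `l + 1`. -/
def IsEdgeLabel (bit : ℕ → Fin n → Fin d → Prop) (l : ℕ) (z : Label K n d) : Prop :=
  if K ≤ l ∧ l ≤ 2 * K then Consistent bit (l - K) z else z.2 = 0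

/-- The vertex `p` belongs to the construction proper; the other vertices are only there to make
the number of vertices independent of `bit`. -/
def IsProper (bit : ℕ → Fin n → Fin d → Prop) (p : Vertex K n d) : Prop :=
  proj p.1 p.2 = p.2 ∧ (K < p.1 → p.1 ≤ 2 * K → Consistent bit (p.1 - K) p.2)

/-- The oriented edges: those between consecutive layers, and those from the hub `(0, 0)` to the
improper vertices. -/
inductive Link (bit : ℕ → Fin n → Fin d → Prop) : Vertex K n d → Vertex K n d → Prop
  | layer (l : ℕ) (z : Label K n d) (hl : l < 3 * K + 1) (h : IsEdgeLabel bit l z) :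
      Link bit (l, proj l z) (l + 1, proj (l + 1) z)
  | leaf (l : ℕ) (z : Label K n d) (hl : l < 3 * K + 2) (h : ¬ IsProper bit (l, z)) :
      Link bit (0, 0) (l, z)

/-- The layered graph: a path from the hub to each vertex of layer `K`, edges for the consistent
labels from layer `K` to layer `2K + 1`, a pendant path at each vertex of layer `2K + 1`, and the
improper vertices as leaves at the hub. -/
def layered (bit : ℕ → Fin n → Fin d → Prop) : SimpleGraph (Vertex K n d) :=
  SimpleGraph.fromRel (Link bit)

variable {bit : ℕ → Fin n → Fin d → Prop}

theorem proj_proj (l : ℕ) (z : Label K n d) : proj l (proj l z) = proj l z := by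
  ext q <;> simp only [proj] <;> split_ifs <;> rfl

theorem proj_zero (z : Label K n d) : proj 0 z = 0 := by
  ext q <;> simp [proj]

theorem proj_of_outer {l : ℕ} (z : Label K n d) (h0 : l ≠ 0) (h : l ≤ K ∨ 2 * K < l) :
    proj l z = (z.1, 0) := by
  have hne : ∀ q : Fin K, (q : ℕ) + K + 1 ≠ l := fun q => by omega
  simp [proj, h0, hne, show ¬ (K < l ∧ l ≤ 2 * K) by omega]

theorem proj_fst_apply_of_eq {l : ℕ} (z : Label K n d) {q : Fin K} (h : (q : ℕ) + K + 1 = l) :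
    (proj l z).1 q = 0 :=
  if_pos (.inr h)

theorem proj_fst_apply_of_ne {l : ℕ} (z : Label K n d) (h0 : l ≠ 0) {q : Fin K}
    (h : (q : ℕ) + K + 1 ≠ l) : (proj l z).1 q = z.1 q := by
  simp [proj, h0, h]

theorem proj_snd {l : ℕ} (z : Label K n d) (h : K < l ∧ l ≤ 2 * K) : (proj l z).2 = z.2 := by
  simp [proj, h]

omit [NeZero n] in
theorem isEdgeLabel_of_inner {l : ℕ} {z : Label K n d} (h : K ≤ l ∧ l ≤ 2 * K) :
    IsEdgeLabel bit l z ↔ Consistent bit (l - K) z := by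
  simp [IsEdgeLabel, h]

omit [NeZero n] in
theorem isEdgeLabel_of_outer {l : ℕ} {z : Label K n d} (h : ¬ (K ≤ l ∧ l ≤ 2 * K)) :
    IsEdgeLabel bit l z ↔ z.2 = 0 := by
  simp [IsEdgeLabel, h]

theorem isProper_hub : IsProper bit ((0, 0) : Vertex K n d) :=
  ⟨proj_zero _, fun h => absurd h (by simp)⟩

theorem isProper_of_outer {l : ℕ} (D : Fin K → Fin n) (h0 : l ≠ 0) (h : l ≤ K ∨ 2 * K < l) :
    IsProper bit ((l, (D, 0)) : Vertex K n d) :=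
  ⟨proj_of_outer _ h0 h, fun (h1 : K < l) (h2 : l ≤ 2 * K) => by omega⟩

theorem IsProper.eq_of_outer {l : ℕ} {z : Label K n d} (hz : IsProper bit (l, z)) (h0 : l ≠ 0)
    (h : l ≤ K ∨ 2 * K < l) : z = (z.1, 0) :=
  hz.1.symm.trans (proj_of_outer z h0 h)

theorem IsProper.eq_zero {z : Label K n d} (hz : IsProper bit (0, z)) : z = 0 :=
  hz.1.symm.trans (proj_zero z)

theorem IsEdgeLabel.isProper_left (hzero : ∀ p x, bit p 0 x) {l : ℕ} {z : Label K n d}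
    (h : IsEdgeLabel bit l z) : IsProper bit (l, proj l z) := by
  refine ⟨proj_proj l z, fun (h1 : K < l) (h2 : l ≤ 2 * K) q m => ?_⟩
  have hcons := (isEdgeLabel_of_inner ⟨h1.le, h2⟩).1 h q m
  simp only [proj_snd z ⟨h1, h2⟩]
  by_cases hq : (q : ℕ) + K + 1 = l
  · rw [proj_fst_apply_of_eq z hq]
    exact ⟨fun _ _ => hzero _ _, fun _ _ => hzero _ _⟩
  · rwa [proj_fst_apply_of_ne z (by omega) hq]

theorem IsEdgeLabel.isProper_right (hzero : ∀ p x, bit p 0 x) {l : ℕ} {z : Label K n d}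
    (h : IsEdgeLabel bit l z) : IsProper bit (l + 1, proj (l + 1) z) := by
  refine ⟨proj_proj _ z, fun (h1 : K < l + 1) (h2 : l + 1 ≤ 2 * K) q m => ?_⟩
  have hcons := (isEdgeLabel_of_inner ⟨by omega, by omega⟩).1 h q m
  simp only [proj_snd z ⟨h1, h2⟩]
  by_cases hq : (q : ℕ) + K + 1 = l + 1
  · rw [proj_fst_apply_of_eq z hq]
    exact ⟨fun _ _ => hzero _ _, fun _ _ => hzero _ _⟩
  · rw [proj_fst_apply_of_ne z (by omega) hq]
    exact ⟨fun h3 => hcons.1 (by omega), fun h3 => hcons.2 (by omega)⟩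

theorem IsProper.isEdgeLabel {l : ℕ} {z : Label K n d} (hz : IsProper bit (l, z)) (h1 : K < l)
    (h2 : l ≤ 2 * K) : IsEdgeLabel bit l z :=
  (isEdgeLabel_of_inner ⟨h1.le, h2⟩).2 (hz.2 h1 h2)

theorem IsProper.isEdgeLabel_pred (hzero : ∀ p x, bit p 0 x) {l : ℕ} {z : Label K n d}
    (hz : IsProper bit (l + 1, z)) (h1 : K < l + 1) (h2 : l + 1 ≤ 2 * K) :
    IsEdgeLabel bit l z := by
  refine (isEdgeLabel_of_inner ⟨by omega, by omega⟩).2 fun q m => ?_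
  have hcons : _ ∧ (l + 1 - K ≤ q → _) := hz.2 h1 h2 q m
  refine ⟨fun h => hcons.1 (by simp only; omega), fun h => ?_⟩
  by_cases hq : (q : ℕ) + K + 1 = l + 1
  · have hq0 := proj_fst_apply_of_eq z hq
    rw [show proj (l + 1) z = z from hz.1] at hq0
    rw [hq0]
    exact fun _ => hzero _ _
  · exact hcons.2 (by omega)

theorem Link.ne {p p' : Vertex K n d} (h : Link bit p p') : p ≠ p' := by
  cases h with
  | layer l z hl h => exact fun e => by simpa using congrArg Prod.fst e
  | leaf l z hl h => exact fun e => h (e ▸ isProper_hub)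

theorem layered_adj {p p' : Vertex K n d} :
    (layered bit).Adj p p' ↔ Link bit p p' ∨ Link bit p' p := by
  rw [layered, SimpleGraph.fromRel_adj]
  exact ⟨fun h => h.2, fun h => ⟨h.elim Link.ne fun h => h.ne.symm, h⟩⟩

theorem Link.edist_le {p p' : Vertex K n d} (h : Link bit p p') :
    (layered bit).edist p p' ≤ (1 : ℕ) := by
  simpa using (layered_adj.2 (.inl h)).toWalk.edist_le

theorem edist_trans_le {V : Type*} {G : SimpleGraph V} {u v w : V} {a b c : ℕ}
    (huv : G.edist u v ≤ a) (hvw : G.edist v w ≤ b) (h : a + b ≤ c) : G.edist u w ≤ c :=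
  SimpleGraph.edist_triangle.trans ((add_le_add huv hvw).trans (mod_cast h))

theorem reachable_of_edist_le {V : Type*} {G : SimpleGraph V} {u v : V} {c : ℕ}
    (h : G.edist u v ≤ c) : G.Reachable u v :=
  SimpleGraph.edist_ne_top_iff_reachable.1 (ne_top_of_le_ne_top (ENat.natCast_ne_top _) h)

/-! ### Connectedness and short distances -/

theorem edist_hub_le (D : Fin K → Fin n) {l : ℕ} (hl : l ≠ 0) (hK : l ≤ K) :
    (layered bit).edist ((0, 0) : Vertex K n d) (l, (D, 0)) ≤ l := by
  induction l with
  | zero => exact absurd rfl hl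
  | succ l ih =>
    have hedge : IsEdgeLabel bit l ((D, 0) : Label K n d) :=
      (isEdgeLabel_of_outer (by omega)).2 rfl
    have hlast := (Link.layer l _ (by omega) hedge).edist_le
    rw [proj_of_outer _ (Nat.succ_ne_zero l) (.inl hK)] at hlast
    rcases eq_or_ne l 0 with rfl | h0
    · simpa [proj_zero] using hlast
    · rw [proj_of_outer _ h0 (.inl (by omega))] at hlast
      exact edist_trans_le (ih h0 (by omega)) hlast le_rfl

theorem edist_pendant_le (D : Fin K → Fin n) {l : ℕ} (h1 : 2 * K + 1 ≤ l) (h2 : l ≤ 3 * K + 1) :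
    (layered bit).edist ((2 * K + 1, (D, 0)) : Vertex K n d) (l, (D, 0)) ≤
      (l - (2 * K + 1) : ℕ) := by
  induction l, h1 using Nat.le_induction with
  | base => simp
  | succ l hl ih =>
    have hedge : IsEdgeLabel bit l ((D, 0) : Label K n d) :=
      (isEdgeLabel_of_outer (by omega)).2 rfl
    have hlast := (Link.layer l _ (by omega) hedge).edist_le
    rw [proj_of_outer _ (by omega) (.inr (by omega)),
      proj_of_outer _ (by omega) (.inr (by omega))] at hlast
    exact edist_trans_le (ih (by omega)) hlast (by omega)

theorem IsProper.exists_edist_le (hzero : ∀ p x, bit p 0 x) {l : ℕ} {z : Label K n d}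
    (hz : IsProper bit (l, z)) (h1 : K < l) (h2 : l ≤ 2 * K + 1) :
    ∃ D, (layered bit).edist (l, z) (2 * K + 1, (D, 0)) ≤ (2 * K + 1 - l : ℕ) := by
  obtain ⟨j, hj⟩ := Nat.exists_eq_add_of_le h2
  induction j generalizing l z with
  | zero =>
    obtain rfl : l = 2 * K + 1 := hj.symm
    refine ⟨z.1, ?_⟩
    rw [← hz.eq_of_outer (by omega) (.inr (by omega))]
    simp
  | succ j ih =>
    have hedge := hz.isEdgeLabel h1 (by omega)
    obtain ⟨D, hD⟩ := ih (hedge.isProper_right hzero) (by omega) (by omega) (by omega)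
    have hfirst := (Link.layer l z (by omega) hedge).edist_le
    rw [show proj l z = z from hz.1] at hfirst
    exact ⟨D, edist_trans_le hfirst hD (by omega)⟩

theorem IsProper.reachable_inner (hzero : ∀ p x, bit p 0 x) (hK : K ≠ 0) {l : ℕ} (h1 : K ≤ l)
    (h2 : l ≤ 2 * K) : ∀ z : Label K n d, IsProper bit (l, z) →
      (layered bit).Reachable (0, 0) (l, z) := by
  induction l, h1 using Nat.le_induction with
  | base =>
    intro z hz
    rw [hz.eq_of_outer hK (.inl le_rfl)]
    exact reachable_of_edist_le (edist_hub_le z.1 hK le_rfl)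
  | succ l hl ih =>
    intro z hz
    have hedge := hz.isEdgeLabel_pred hzero (by omega) h2
    have hlast := (layered_adj.2 (.inl (Link.layer l z (by omega) hedge))).reachable
    rw [show proj (l + 1) z = z from hz.1] at hlast
    exact (ih (by omega) _ (hedge.isProper_left hzero)).trans hlast

theorem reachable_outer (hzero : ∀ p x, bit p 0 x) (hone : ∃ x, ∀ p < K, ∀ v, bit p v x)
    (hK : K ≠ 0) (D : Fin K → Fin n) {l : ℕ} (h1 : 2 * K + 1 ≤ l) (h2 : l ≤ 3 * K + 1) :
    (layered bit).Reachable ((0, 0) : Vertex K n d) (l, (D, 0)) := by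
  obtain ⟨x, hx⟩ := hone
  have hedge : IsEdgeLabel bit (2 * K) ((D, fun _ => x) : Label K n d) :=
    (isEdgeLabel_of_inner ⟨by omega, le_rfl⟩).2 fun q m =>
      ⟨fun _ _ => hx q q.2 _, fun h => by omega⟩
  have hinner := (hedge.isProper_left hzero).reachable_inner hzero hK (by omega) le_rfl
  have hlink := (layered_adj.2 (.inl (Link.layer (2 * K) _ (by omega) hedge))).reachable
  rw [proj_of_outer (l := 2 * K + 1) _ (by omega) (.inr (by omega))] at hlink
  exact (hinner.trans hlink).trans (reachable_of_edist_le (edist_pendant_le D h1 h2))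

theorem reachable_hub (hzero : ∀ p x, bit p 0 x) (hone : ∃ x, ∀ p < K, ∀ v, bit p v x)
    (hK : K ≠ 0) {l : ℕ} (z : Label K n d) (hl : l < 3 * K + 2) :
    (layered bit).Reachable ((0, 0) : Vertex K n d) (l, z) := by
  by_cases hz : IsProper bit (l, z)
  swap
  · exact reachable_of_edist_le (Link.leaf l z hl hz).edist_le
  rcases eq_or_ne l 0 with rfl | h0
  · rw [hz.eq_zero]
  rcases le_or_gt l K with hlK | hKl
  · rw [hz.eq_of_outer h0 (.inl hlK)]
    exact reachable_of_edist_le (edist_hub_le z.1 h0 hlK)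
  rcases le_or_gt l (2 * K) with hl2 | hl2
  · exact hz.reachable_inner hzero hK hKl.le hl2
  · rw [hz.eq_of_outer h0 (.inr hl2)]
    exact reachable_outer hzero hone hK z.1 (by omega) (by omega)

omit [NeZero d] in
theorem exists_coordinates (hcommon : ∀ v : ℕ → Fin n, ∃ x, ∀ p ≤ K, bit p (v p) x)
    (a b : Fin K → Fin n) : ∃ X : Fin K → Fin d, ∀ m q : Fin K,
      (q ≤ m → bit q (b q) (X m)) ∧ (m ≤ q → bit (q + 1) (a q) (X m)) := by
  have hlabel (m : Fin K) : ∃ x, ∀ q : Fin K,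
      (q ≤ m → bit q (b q) x) ∧ (m ≤ q → bit (q + 1) (a q) x) := by
    obtain ⟨x, hx⟩ := hcommon fun p => if h : p ≤ m then b ⟨p, by omega⟩ else
      if h' : p - 1 < K then a ⟨p - 1, h'⟩ else 0
    refine ⟨x, fun q => ⟨fun h => ?_, fun h => ?_⟩⟩
    · simpa [Fin.le_def.1 h] using hx q (by omega)
    · simpa [show ¬ (q : ℕ) + 1 ≤ m by have := Fin.le_def.1 h; omega] using hx (q + 1) (by omega)
  choose X hX using hlabel
  exact ⟨X, hX⟩

/-- The label of the edge between the layers `K + i` and `K + i + 1` on the path from `(K, a)` to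
`(2K + 1, b)` with the coordinates `X`. -/
def crossing (a b : Fin K → Fin n) (X : Fin K → Fin d) (i : ℕ) : Label K n d :=
  (fun q => if (q : ℕ) < i then b q else a q, X)

omit [NeZero n] in
theorem isEdgeLabel_crossing {a b : Fin K → Fin n} {X : Fin K → Fin d}
    (hX : ∀ m q : Fin K, (q ≤ m → bit q (b q) (X m)) ∧ (m ≤ q → bit (q + 1) (a q) (X m)))
    {i : ℕ} (hi : i ≤ K) : IsEdgeLabel bit (K + i) (crossing a b X i) := by
  refine (isEdgeLabel_of_inner ⟨by omega, by omega⟩).2 fun q m => ?_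
  rw [Nat.add_sub_cancel_left]
  exact ⟨fun h => by simpa [crossing, h] using (hX m q).1,
    fun h => by simpa [crossing, not_lt.2 h] using (hX m q).2⟩

theorem proj_crossing_succ (a b : Fin K → Fin n) (X : Fin K → Fin d) (i : ℕ) :
    proj (K + i + 1) (crossing a b X i) = proj (K + i + 1) (crossing a b X (i + 1)) := by
  ext q
  · simp only [proj, crossing]
    by_cases hq : (q : ℕ) + K + 1 = K + i + 1
    · simp [hq]
    · simp [show (q : ℕ) < i ↔ (q : ℕ) < i + 1 by omega]
  · simp [proj, crossing]

theorem edist_across_le (hcommon : ∀ v : ℕ → Fin n, ∃ x, ∀ p ≤ K, bit p (v p) x) (hK : K ≠ 0)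
    (a b : Fin K → Fin n) :
    (layered bit).edist ((K, (a, 0)) : Vertex K n d) (2 * K + 1, (b, 0)) ≤ (K + 1 : ℕ) := by
  obtain ⟨X, hX⟩ := exists_coordinates hcommon a b
  have along : ∀ i ≤ K + 1, (layered bit).edist ((K, (a, 0)) : Vertex K n d)
      (K + i, proj (K + i) (crossing a b X i)) ≤ (i : ℕ) := by
    intro i hi
    induction i with
    | zero => simp [proj_of_outer _ hK, crossing]
    | succ i ih =>
      have hlast := (Link.layer (K + i) _ (by omega)
        (isEdgeLabel_crossing hX (by omega : i ≤ K))).edist_le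
      rw [proj_crossing_succ] at hlast
      exact edist_trans_le (ih (by omega)) hlast (by omega)
  have hend : proj (K + (K + 1)) (crossing a b X (K + 1)) = (b, 0) := by
    rw [proj_of_outer _ (by omega) (.inr (by omega)), crossing]
    exact Prod.ext (funext fun q => if_pos (by omega)) rfl
  have hlast := along (K + 1) le_rfl
  rwa [hend, show K + (K + 1) = 2 * K + 1 by omega] at hlast

theorem edist_le_of_common (hzero : ∀ p x, bit p 0 x)
    (hcommon : ∀ v : ℕ → Fin n, ∃ x, ∀ p ≤ K, bit p (v p) x) (hK : K ≠ 0) (a : Fin K → Fin n)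
    {l : ℕ} (z : Label K n d) (hl : l < 3 * K + 2) :
    (layered bit).edist ((K, (a, 0)) : Vertex K n d) (l, z) ≤ (2 * K + 1 : ℕ) := by
  have hhub := edist_hub_le (bit := bit) (d := d) a hK le_rfl
  rw [SimpleGraph.edist_comm] at hhub
  by_cases hz : IsProper bit (l, z)
  swap
  · exact edist_trans_le hhub (Link.leaf l z hl hz).edist_le (by omega)
  rcases eq_or_ne l 0 with rfl | h0
  · rw [hz.eq_zero]
    exact hhub.trans (mod_cast by omega)
  rcases le_or_gt l K with hlK | hKl
  · rw [hz.eq_of_outer h0 (.inl hlK)]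
    exact edist_trans_le hhub (edist_hub_le z.1 h0 hlK) (by omega)
  rcases le_or_gt l (2 * K) with hl2 | hl2
  · obtain ⟨D, hD⟩ := hz.exists_edist_le hzero hKl (by omega)
    rw [SimpleGraph.edist_comm] at hD
    exact edist_trans_le (edist_across_le hcommon hK a D) hD (by omega)
  · rw [hz.eq_of_outer h0 (.inr hl2)]
    exact edist_trans_le (edist_across_le hcommon hK a z.1)
      (edist_pendant_le z.1 (by omega) (by omega)) (by omega)

/-! ### Distances in the presence of an orthogonal tuple -/

variable (bit) in
/-- What is known about the vertex `(l, z)` if a walk from `(K, (a, 0))` that avoids the hub leads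
to it. Gap `g` lies between the layers `K + g` and `K + g + 1`, and `B` contains the gaps that the
walk has crossed backwards. -/
structure HubFreeTrace (a : Fin K → Fin n) (B : Finset ℕ) (l : ℕ) (z : Label K n d) : Prop where
  notMem_of_ge : ∀ g, l ≤ K + g → g ∉ B → ∀ g' ≥ g, g' ∉ B
  fst_eq : ∀ g, l ≤ K + g → g ∉ B → ∀ q : Fin K, g ≤ q → z.1 q = a q
  bit_source : ∀ g, K + g < l → l ≤ 2 * K → g ∉ B → K ∉ B →
    ∀ q m : Fin K, g ≤ q → m ≤ q → bit (q + 1) (a q) (z.2 m)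
  exists_coordinates : ∀ g g', g < g' → g' ≤ K → K + g' < l → g ∉ B → g' ∉ B →
    ∃ X : Fin K → Fin d, (∀ q m : Fin K, g ≤ q → m ≤ q → bit (q + 1) (a q) (X m)) ∧
      ∀ q m : Fin K, (q : ℕ) < g' → q ≤ m → bit q (z.1 q) (X m)

theorem HubFreeTrace.forward {a : Fin K → Fin n} {B : Finset ℕ} {l : ℕ} {z : Label K n d}
    (h : HubFreeTrace bit a B l (proj l z)) (hl : l ≠ 0) (hz : IsEdgeLabel bit l z) :
    HubFreeTrace bit a B (l + 1) (proj (l + 1) z) where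
  notMem_of_ge g hg := h.notMem_of_ge g (by omega)
  fst_eq g hg hB q hq := by
    have hfst := h.fst_eq g (by omega) hB q hq
    rwa [proj_fst_apply_of_ne z (by omega) (by omega)] at hfst ⊢
  bit_source g hg hl2 hB hK q m hq hm := by
    rw [proj_snd z (by omega)]
    by_cases hgl : K + g = l
    · have hfst := h.fst_eq g (by omega) hB q hq
      rw [proj_fst_apply_of_ne z hl (by omega)] at hfst
      rw [← hfst]
      exact ((isEdgeLabel_of_inner (by omega)).1 hz q m).2 (by omega) hm
    · have hbit := h.bit_source g (by omega) (by omega) hB hK q m hq hm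
      rwa [proj_snd z (by omega)] at hbit
  exists_coordinates g g' hgg hg' hl' hB hB' := by
    by_cases hgl : K + g' = l
    · have hK := h.notMem_of_ge g' (by omega) hB' K hg'
      refine ⟨z.2, fun q m hq hm => ?_, fun q m hq hm => ?_⟩
      · have hbit := h.bit_source g (by omega) (by omega) hB hK q m hq hm
        rwa [proj_snd z (by omega)] at hbit
      · rw [proj_fst_apply_of_ne z (by omega) (by omega)]
        exact ((isEdgeLabel_of_inner (by omega)).1 hz q m).1 (by omega) hm
    · obtain ⟨X, hX, hX'⟩ := h.exists_coordinates g g' hgg hg' (by omega) hB hB'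
      refine ⟨X, hX, fun q m hq hm => ?_⟩
      have hbit := hX' q m hq hm
      rwa [proj_fst_apply_of_ne z (by omega) (by omega)] at hbit ⊢

theorem HubFreeTrace.backward {a : Fin K → Fin n} {B : Finset ℕ} {l : ℕ} {z : Label K n d}
    (h : HubFreeTrace bit a B (l + 1) (proj (l + 1) z)) (hl : l ≠ 0) :
    HubFreeTrace bit a (insert (l - K) B) l (proj l z) := by
  constructor <;> simp only [Finset.mem_insert, not_or]
  · exact fun g hg hB g' hg' => ⟨by omega, h.notMem_of_ge g (by omega) hB.2 g' hg'⟩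
  · intro g hg hB q hq
    have hfst := h.fst_eq g (by omega) hB.2 q hq
    rwa [proj_fst_apply_of_ne z (by omega) (by omega)] at hfst ⊢
  · intro g hg hl2 hB hK q m hq hm
    have hbit := h.bit_source g (by omega) (by omega) hB.2 hK.2 q m hq hm
    rwa [proj_snd z (by omega)] at hbit ⊢
  · intro g g' hgg hg' hl' hB hB'
    obtain ⟨X, hX, hX'⟩ := h.exists_coordinates g g' hgg hg' (by omega) hB.2 hB'.2
    refine ⟨X, hX, fun q m hq hm => ?_⟩
    have hbit := hX' q m hq hm
    rwa [proj_fst_apply_of_ne z (by omega) (by omega)] at hbit ⊢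

omit [NeZero n] in
theorem HubFreeTrace.start (a : Fin K → Fin n) :
    HubFreeTrace bit a ∅ K ((a, 0) : Label K n d) where
  notMem_of_ge := by simp
  fst_eq _ _ _ _ _ := rfl
  bit_source g hg := by omega
  exists_coordinates g g' _ _ hg := by omega

open Classical in
variable (bit) in
/-- A lower bound for the distance from the hub. -/
noncomputable def height (p : Vertex K n d) : ℕ := if IsProper bit p then p.1 else 1

variable (bit) in
/-- What is known about a vertex that a walk of `s` steps from `(K, (a, 0))` leads to: `u` steps
forwards and `b` steps backwards avoid the hub, or else the walk has passed through the hub. -/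
def Reached (a : Fin K → Fin n) (s : ℕ) (p : Vertex K n d) : Prop :=
  (p.1 ≠ 0 ∧ IsProper bit p ∧ ∃ (u b : ℕ) (B : Finset ℕ), s = u + b ∧ p.1 + b = K + u ∧
    B.card ≤ b ∧ HubFreeTrace bit a B p.1 p.2) ∨ K + height bit p ≤ s

theorem height_of_isProper {p : Vertex K n d} (h : IsProper bit p) : height bit p = p.1 :=
  if_pos h

theorem height_of_not_isProper {p : Vertex K n d} (h : ¬ IsProper bit p) : height bit p = 1 :=
  if_neg h

theorem Reached.ascend (hzero : ∀ p x, bit p 0 x) {a : Fin K → Fin n} {s : ℕ}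
    {p p' : Vertex K n d} (h : Reached bit a s p) (hp : Link bit p p') :
    Reached bit a (s + 1) p' := by
  cases hp with
  | layer l z hl hz =>
    have hlow := height_of_isProper (hz.isProper_left hzero)
    have hhigh := height_of_isProper (hz.isProper_right hzero)
    rcases h with ⟨hl0, -, u, b, B, hs, hlub, hB, htrace⟩ | h
    · exact .inl ⟨Nat.succ_ne_zero l, hz.isProper_right hzero, u + 1, b, B, by omega,
        by simp only at hlub ⊢; omega, hB, htrace.forward hl0 hz⟩
    · exact .inr (by simp only at hlow hhigh; omega)
  | leaf l z hl hz =>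
    have hhub := height_of_isProper (isProper_hub (bit := bit) (K := K))
    have hleaf := height_of_not_isProper hz
    rcases h with ⟨hl0, -⟩ | h
    · exact absurd rfl hl0
    · exact .inr (by simp only at hhub; omega)

theorem Reached.descend (hzero : ∀ p x, bit p 0 x) {a : Fin K → Fin n} {s : ℕ}
    {p p' : Vertex K n d} (h : Reached bit a s p') (hp : Link bit p p') :
    Reached bit a (s + 1) p := by
  cases hp with
  | layer l z hl hz =>
    have hlow := height_of_isProper (hz.isProper_left hzero)
    have hhigh := height_of_isProper (hz.isProper_right hzero)
    simp only at hlow hhigh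
    rcases h with ⟨-, -, u, b, B, hs, hlub, hB, htrace⟩ | h
    · rcases eq_or_ne l 0 with rfl | hl0
      · exact .inr (by simp only at hlub; omega)
      · exact .inl ⟨hl0, hz.isProper_left hzero, u, b + 1, _, by omega,
          by simp only at hlub ⊢; omega,
          (Finset.card_insert_le _ _).trans (Nat.succ_le_succ hB), htrace.backward hl0⟩
    · exact .inr (by omega)
  | leaf l z hl hz =>
    have hhub := height_of_isProper (isProper_hub (bit := bit) (K := K))
    have hleaf := height_of_not_isProper hz
    rcases h with ⟨-, hproper, -⟩ | h
    · exact absurd hproper hz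
    · exact .inr (by simp only at hhub; omega)

theorem Reached.walk (hzero : ∀ p x, bit p 0 x) {a : Fin K → Fin n} {p p' : Vertex K n d}
    (w : (layered bit).Walk p p') {s : ℕ} (h : Reached bit a s p) :
    Reached bit a (s + w.length) p' := by
  induction w generalizing s with
  | nil => simpa using h
  | cons hadj w ih =>
    have hnext := ih ((layered_adj.1 hadj).elim (h.ascend hzero) (h.descend hzero))
    rwa [SimpleGraph.Walk.length_cons, add_comm w.length, ← add_assoc]

theorem exists_lt_notMem {K : ℕ} {B : Finset ℕ} (hB : B.card < K) :
    ∃ g g', g < g' ∧ g' ≤ K ∧ g ∉ B ∧ g' ∉ B := by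
  have hcard : 1 < (Finset.range (K + 1) \ B).card := by
    have hle := Finset.le_card_sdiff B (Finset.range (K + 1))
    rw [Finset.card_range] at hle
    omega
  obtain ⟨g₁, h₁, g₂, h₂, hne⟩ := Finset.one_lt_card.1 hcard
  simp only [Finset.mem_sdiff, Finset.mem_range] at h₁ h₂
  rcases hne.lt_or_gt with h | h
  · exact ⟨g₁, g₂, h, by omega, h₁.2, h₂.2⟩
  · exact ⟨g₂, g₁, h, by omega, h₂.2, h₁.2⟩

omit [NeZero n] [NeZero d] in
theorem HubFreeTrace.exists_common {v : ℕ → Fin n} {B : Finset ℕ} {l : ℕ} {z : Label K n d}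
    (h : HubFreeTrace bit (fun q => v (q + 1)) B l z) (hl : 2 * K < l) (hB : B.card < K)
    (hz : ∀ q : Fin K, z.1 q = v q) : ∃ x, ∀ p ≤ K, bit p (v p) x := by
  obtain ⟨g, g', hgg, hg', hgB, hgB'⟩ := exists_lt_notMem hB
  obtain ⟨X, hX, hX'⟩ := h.exists_coordinates g g' hgg hg' (by omega) hgB hgB'
  refine ⟨X ⟨g' - 1, by omega⟩, fun p hp => ?_⟩
  by_cases hpg : p < g'
  · have hbit := hX' ⟨p, by omega⟩ ⟨g' - 1, by omega⟩ hpg (Fin.mk_le_mk.2 (by omega))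
    rwa [hz] at hbit
  · obtain ⟨p, rfl⟩ := Nat.exists_eq_succ_of_ne_zero (by omega : p ≠ 0)
    exact hX ⟨p, by omega⟩ ⟨g' - 1, by omega⟩ (by simp only; omega) (Fin.mk_le_mk.2 (by omega))

theorem le_length_of_not_common (hzero : ∀ p x, bit p 0 x) {v : ℕ → Fin n}
    (hv : ¬ ∃ x, ∀ p ≤ K, bit p (v p) x) (hK : K ≠ 0)
    (w : (layered bit).Walk ((K, (fun q => v (q + 1), 0)) : Vertex K n d)
      (3 * K + 1, (fun q => v q, 0))) : 4 * K + 1 ≤ w.length := by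
  have hstart : Reached bit (fun q => v (q + 1)) 0
      ((K, (fun q => v (q + 1), 0)) : Vertex K n d) :=
    .inl ⟨hK, isProper_of_outer _ hK (.inl le_rfl), 0, 0, ∅, rfl, rfl, le_rfl, .start _⟩
  rcases hstart.walk hzero w with ⟨-, -, u, b, B, hs, hlub, hB, htrace⟩ | h
  · simp only at hlub
    by_contra hlt
    exact hv (htrace.exists_common (by simp only; omega) (by omega) fun _ => rfl)
  · rw [height_of_isProper (isProper_of_outer _ (by omega) (.inr (by omega)))] at h
    simp only at h
    omega

end Layered

/-! ### Numbering the vertices -/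

namespace Layered

theorem edist_comap {V W : Type*} {G : SimpleGraph W} {f : V → W} (hf : f.Injective)
    (hadj : ∀ v w, G.Adj (f v) w → w ∈ Set.range f) (u v : V) :
    (G.comap f).edist u v = G.edist (f u) (f v) := by
  have lift : ∀ {x y} (w : G.Walk x y), ∀ u v, f u = x → f v = y →
      (G.comap f).edist u v ≤ w.length := by
    intro x y w
    induction w with
    | nil =>
      intro u v hu hv
      simp [hf (hu.trans hv.symm)]
    | cons h w ih =>
      rintro u v rfl hv
      obtain ⟨u', rfl⟩ := hadj u _ h
      have hfirst := (SimpleGraph.Walk.cons (G := G.comap f) h .nil).edist_le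
      exact edist_trans_le hfirst (ih u' v rfl hv) (Nat.add_comm _ _).le
  refine le_antisymm (le_iInf fun w => lift w u v rfl rfl) (le_iInf fun w => ?_)
  exact (w.map (⟨f, id⟩ : G.comap f →g G)).edist_le.trans_eq (by simp)

variable {K n d : ℕ}

variable (K n d) in
/-- The number of vertices in a layer. -/
def width : ℕ := n ^ K * d ^ K

variable (K n d) in
/-- The number of vertices of the layered graph. -/
def order : ℕ := (3 * K + 2) * width K n d

/-- The labels, numbered in lexicographic order, with the vector indices first; in each half of a
label, position `0` is the least significant one. -/
def labelEquiv : Label K n d ≃ Fin (width K n d) :=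
  (finFunctionFinEquiv.prodCongr finFunctionFinEquiv).trans finProdFinEquiv

/-- The number of a vertex: the vertices are numbered layer by layer. -/
def number (p : Vertex K n d) : ℕ := p.1 * width K n d + labelEquiv p.2

theorem coe_labelEquiv (z : Label K n d) : (labelEquiv z : ℕ) =
    ∑ q, (z.2 q : ℕ) * d ^ (q : ℕ) + d ^ K * ∑ q, (z.1 q : ℕ) * n ^ (q : ℕ) := by
  have h : (labelEquiv z : ℕ) =
      finProdFinEquiv (finFunctionFinEquiv z.1, finFunctionFinEquiv z.2) := rfl
  simpa [finFunctionFinEquiv_apply] using h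

theorem coe_fst_apply (z : Label K n d) (q : Fin K) :
    (z.1 q : ℕ) = labelEquiv z / d ^ K / n ^ (q : ℕ) % n := by
  conv_lhs => rw [← labelEquiv.symm_apply_apply z]
  exact finFunctionFinEquiv_symm_apply_val _ _

theorem coe_snd_apply (z : Label K n d) (q : Fin K) :
    (z.2 q : ℕ) = labelEquiv z % d ^ K / d ^ (q : ℕ) % d := by
  conv_lhs => rw [← labelEquiv.symm_apply_apply z]
  exact finFunctionFinEquiv_symm_apply_val _ _

theorem sum_snd_eq_mod (z : Label K n d) :
    ∑ q, (z.2 q : ℕ) * d ^ (q : ℕ) = labelEquiv z % d ^ K := by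
  have hlt := (finFunctionFinEquiv z.2).2
  rw [finFunctionFinEquiv_apply] at hlt
  rw [coe_labelEquiv, Nat.add_mul_mod_self_left, Nat.mod_eq_of_lt hlt]

theorem number_lt {p : Vertex K n d} (hp : p.1 < 3 * K + 2) : number p < order K n d :=
  calc number p < (p.1 + 1) * width K n d := by
        rw [number, Nat.succ_mul]
        exact Nat.add_lt_add_left (labelEquiv p.2).2 _
    _ ≤ order K n d := Nat.mul_le_mul_right _ hp

variable [NeZero n] [NeZero d]

instance : NeZero (width K n d) :=
  ⟨(Nat.mul_pos (pow_pos (NeZero.pos n) _) (pow_pos (NeZero.pos d) _)).ne'⟩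

instance : NeZero (order K n d) := ⟨(Nat.mul_pos (by omega) (NeZero.pos _)).ne'⟩

/-- The label with number `y`, for `y` less than the width. -/
def labelAt (y : ℕ) : Label K n d := labelEquiv.symm (Fin.ofNat (width K n d) y)

/-- The vertex with number `v`. -/
def vertexAt (v : Fin (order K n d)) : Vertex K n d :=
  ((v : ℕ) / width K n d, labelAt ((v : ℕ) % width K n d))

theorem labelAt_labelEquiv (z : Label K n d) : labelAt (labelEquiv z) = z := by
  simp [labelAt]

theorem labelEquiv_labelAt {y : ℕ} (hy : y < width K n d) :
    (labelEquiv (labelAt y : Label K n d) : ℕ) = y := by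
  simp [labelAt, Nat.mod_eq_of_lt hy]

theorem labelEquiv_zero : (labelEquiv (0 : Label K n d) : ℕ) = 0 := by
  simp [coe_labelEquiv]

theorem number_vertexAt (v : Fin (order K n d)) : number (vertexAt v) = v := by
  simp only [number, vertexAt]
  rw [labelEquiv_labelAt (Nat.mod_lt _ (NeZero.pos _)), Nat.div_add_mod']

theorem vertexAt_fst_lt (v : Fin (order K n d)) : (vertexAt v).1 < 3 * K + 2 :=
  Nat.div_lt_of_lt_mul (by rw [mul_comm]; exact v.2)

theorem vertexAt_number {p : Vertex K n d} (hp : p.1 < 3 * K + 2) :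
    vertexAt (Fin.ofNat (order K n d) (number p)) = p := by
  have hlt := (labelEquiv p.2).2
  simp only [vertexAt, Fin.val_ofNat, Nat.mod_eq_of_lt (number_lt hp)]
  rw [number, mul_comm, Nat.mul_add_div (NeZero.pos _), Nat.mul_add_mod, Nat.mod_eq_of_lt hlt,
    Nat.div_eq_of_lt hlt, labelAt_labelEquiv, add_zero]

theorem vertexAt_injective : (vertexAt : Fin (order K n d) → Vertex K n d).Injective :=
  fun u v h => Fin.ext (by rw [← number_vertexAt u, h, number_vertexAt])

variable {bit : ℕ → Fin n → Fin d → Prop}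

variable (K bit) in
/-- The layered graph with numbered vertices. -/
def graph : SimpleGraph (Fin (order K n d)) := (layered (K := K) bit).comap vertexAt

variable (K n d) in
/-- The vertices of layer `K`, whose eccentricities decide the instance. -/
def source (a : Fin K → Fin n) : Fin (order K n d) :=
  Fin.ofNat _ (number (K, ((a, 0) : Label K n d)))

theorem Link.fst_lt {p p' : Vertex K n d} (h : Link bit p p') :
    p.1 < 3 * K + 2 ∧ p'.1 < 3 * K + 2 := by
  cases h with
  | layer l z hl h => exact ⟨by simp only; omega, by simp only; omega⟩
  | leaf l z hl h => exact ⟨by simp only; omega, hl⟩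

theorem edist_graph (u v : Fin (order K n d)) :
    (graph K bit).edist u v = (layered bit).edist (vertexAt u) (vertexAt v) :=
  edist_comap vertexAt_injective (fun _ _ h => ⟨_, vertexAt_number
    ((layered_adj.1 h).elim (fun h => h.fst_lt.2) fun h => h.fst_lt.1)⟩) u v

theorem connected_graph (hzero : ∀ p x, bit p 0 x) (hone : ∃ x, ∀ p < K, ∀ v, bit p v x)
    (hK : K ≠ 0) : (graph K bit).Connected := by
  have hhub : ∀ v, (graph K bit).Reachable (Fin.ofNat _ (number (0, (0 : Label K n d)))) v := by
    intro v
    rw [← SimpleGraph.edist_ne_top_iff_reachable, edist_graph, vertexAt_number (Nat.succ_pos _),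
      SimpleGraph.edist_ne_top_iff_reachable]
    exact reachable_hub hzero hone hK _ (vertexAt_fst_lt v)
  exact ⟨fun u v => (hhub u).symm.trans (hhub v)⟩

theorem eccent_source_le (hzero : ∀ p x, bit p 0 x)
    (hcommon : ∀ v : ℕ → Fin n, ∃ x, ∀ p ≤ K, bit p (v p) x) (hK : K ≠ 0) (a : Fin K → Fin n) :
    (graph K bit).eccent (source K n d a) ≤ (2 * K + 1 : ℕ) := by
  rw [SimpleGraph.eccent_le_iff]
  intro v
  rw [edist_graph, source, vertexAt_number (by simp only; omega)]
  exact edist_le_of_common hzero hcommon hK a _ (vertexAt_fst_lt v)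

theorem le_eccent_source (hzero : ∀ p x, bit p 0 x) {v : ℕ → Fin n}
    (hv : ¬ ∃ x, ∀ p ≤ K, bit p (v p) x) (hK : K ≠ 0) :
    (4 * K + 1 : ℕ) ≤ (graph K bit).eccent (source K n d fun q => v (q + 1)) := by
  refine le_trans ?_ (SimpleGraph.edist_le_eccent (v :=
    Fin.ofNat (order K n d) (number (3 * K + 1, ((fun q => v q, 0) : Label K n d)))))
  rw [edist_graph, source, vertexAt_number (by simp only; omega),
    vertexAt_number (by simp only; omega)]
  exact le_iInf fun w => mod_cast le_length_of_not_common hzero hv hK w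

/-! ### The list of edges -/

/-- The two ways in which a label gives rise to an edge: between the layers `l` and `l + 1`, or
between the hub and a leaf in layer `l`. -/
inductive EdgeKind
  | layer (l : ℕ)
  | leaf (l : ℕ)

/-- All kinds of edges in the layered graph. -/
def edgeKinds (K : ℕ) : List EdgeKind :=
  (List.range (3 * K + 1)).map .layer ++ (List.range (3 * K + 2)).map .leaf

variable (bit) in
/-- There is an edge of the given kind with label `z`. -/
def EdgeKind.IsPresent : EdgeKind → Label K n d → Prop
  | layer l, z => IsEdgeLabel bit l z
  | leaf l, z => ¬ IsProper bit (l, z)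

/-- The end points of the edge of the given kind with label `z`. -/
def EdgeKind.ends : EdgeKind → Label K n d → Vertex K n d × Vertex K n d
  | layer l, z => ((l, proj l z), (l + 1, proj (l + 1) z))
  | leaf l, z => ((0, 0), (l, z))

open Classical in
variable (K bit) in
/-- The edges whose labels have numbers less than `y`. -/
noncomputable def edgesBelow (y : ℕ) : List (Vertex K n d × Vertex K n d) :=
  ((List.range y ×ˢ edgeKinds K).filter fun p => p.2.IsPresent bit (labelAt p.1 : Label K n d)).map
    fun p => p.2.ends (labelAt p.1)

variable (K bit) in
/-- The list of edges of the numbered graph. -/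
noncomputable def edgeList : List (Fin (order K n d) × Fin (order K n d)) :=
  (edgesBelow K bit (width K n d)).map fun e =>
    (Fin.ofNat _ (number e.1), Fin.ofNat _ (number e.2))

theorem link_iff {p p' : Vertex K n d} : Link bit p p' ↔
    ∃ κ ∈ edgeKinds K, ∃ z, κ.IsPresent bit z ∧ κ.ends z = (p, p') := by
  constructor
  · rintro (⟨l, z, hl, h⟩ | ⟨l, z, hl, h⟩)
    · exact ⟨.layer l, by simpa [edgeKinds] using hl, z, h, rfl⟩
    · exact ⟨.leaf l, by simpa [edgeKinds] using hl, z, h, rfl⟩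
  · rintro ⟨l | l, hl, z, h, he⟩ <;> cases he
    · exact .layer l z (by simpa [edgeKinds] using hl) h
    · exact .leaf l z (by simpa [edgeKinds] using hl) h

theorem mem_edgesBelow_width {e : Vertex K n d × Vertex K n d} :
    e ∈ edgesBelow K bit (width K n d) ↔ Link bit e.1 e.2 := by
  simp only [link_iff, edgesBelow, List.mem_map, List.mem_filter, decide_eq_true_eq]
  constructor
  · rintro ⟨p, ⟨hp, h⟩, rfl⟩
    exact ⟨p.2, (List.mem_product.1 hp).2, _, h, rfl⟩
  · rintro ⟨κ, hκ, z, h, he⟩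
    rw [← labelAt_labelEquiv z] at h he
    exact ⟨(_, κ), ⟨List.mem_product.2 ⟨List.mem_range.2 (labelEquiv z).2, hκ⟩, h⟩, he⟩

theorem length_edgeKinds (K : ℕ) : (edgeKinds K).length = 6 * K + 3 := by
  simp [edgeKinds]
  omega

theorem length_edgesBelow_le (y : ℕ) : (edgesBelow K bit y).length ≤ y * (6 * K + 3) := by
  rw [edgesBelow, List.length_map, ← length_edgeKinds]
  exact (List.length_filter_le _ _).trans_eq (by rw [List.length_product, List.length_range])

theorem length_edgeList_le : (edgeList K bit).length ≤ 2 * order K n d := by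
  rw [edgeList, List.length_map, order]
  refine (length_edgesBelow_le _).trans ?_
  rw [← mul_assoc, mul_comm]
  exact Nat.mul_le_mul_right _ (by omega)

theorem nodup_edgeKinds (K : ℕ) : (edgeKinds K).Nodup := by
  refine (List.nodup_range.map fun a b h => by simpa using h).append
    (List.nodup_range.map fun a b h => by simpa using h) fun κ h h' => ?_
  obtain ⟨l, -, rfl⟩ := List.mem_map.1 h
  simp at h'

theorem eq_of_proj_eq (hK : K ≠ 0) {l : ℕ} {z z' : Label K n d} (h : IsEdgeLabel bit l z)
    (h' : IsEdgeLabel bit l z') (he : proj l z = proj l z')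
    (he' : proj (l + 1) z = proj (l + 1) z') : z = z' := by
  refine Prod.ext (funext fun q => ?_) ?_
  · by_cases hq : l = 0 ∨ (q : ℕ) + K + 1 = l
    · have hfst := congrFun (congrArg Prod.fst he') q
      rwa [proj_fst_apply_of_ne z (by omega) (by omega),
        proj_fst_apply_of_ne z' (by omega) (by omega)] at hfst
    · have hfst := congrFun (congrArg Prod.fst he) q
      rwa [proj_fst_apply_of_ne z (by omega) (by omega),
        proj_fst_apply_of_ne z' (by omega) (by omega)] at hfst
  · by_cases hl : K < l ∧ l ≤ 2 * K
    · rw [← proj_snd z hl, he, proj_snd z' hl]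
    by_cases hl' : K < l + 1 ∧ l + 1 ≤ 2 * K
    · rw [← proj_snd z hl', he', proj_snd z' hl']
    · rw [isEdgeLabel_of_outer (by omega)] at h h'
      rw [h, h']

theorem EdgeKind.ends_inj (hzero : ∀ p x, bit p 0 x) (hK : K ≠ 0) {κ κ' : EdgeKind}
    {z z' : Label K n d} (h : κ.IsPresent bit z) (h' : κ'.IsPresent bit z')
    (he : s((κ.ends z).1, (κ.ends z).2) = s((κ'.ends z').1, (κ'.ends z').2)) :
    κ = κ' ∧ z = z' := by
  have mixed : ∀ {l l' : ℕ} {z z' : Label K n d}, IsEdgeLabel bit l z → ¬ IsProper bit (l', z') →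
      s((l, proj l z), (l + 1, proj (l + 1) z)) ≠ s(((0, 0) : Vertex K n d), (l', z')) := by
    intro l l' z z' h h' he
    rcases Sym2.eq_iff.1 he with ⟨-, e⟩ | ⟨e, -⟩
    · exact h' (e ▸ h.isProper_right hzero)
    · exact h' (e ▸ h.isProper_left hzero)
  rcases κ with l | l <;> rcases κ' with l' | l'
  · rcases Sym2.eq_iff.1 he with ⟨e, e'⟩ | ⟨e, e'⟩
    · obtain rfl : l = l' := congrArg Prod.fst e
      exact ⟨rfl, eq_of_proj_eq hK h h' (congrArg Prod.snd e) (congrArg Prod.snd e')⟩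
    · have hl : l = l' + 1 := congrArg Prod.fst e
      have hl' : l + 1 = l' := congrArg Prod.fst e'
      omega
  · exact absurd he (mixed h h')
  · exact absurd he.symm (mixed h' h)
  · rcases Sym2.eq_iff.1 he with ⟨-, e⟩ | ⟨e, -⟩
    · exact ⟨congrArg EdgeKind.leaf (congrArg Prod.fst e), congrArg Prod.snd e⟩
    · have e : ((0, 0) : Vertex K n d) = (l', z') := e
      exact absurd (e ▸ isProper_hub) h'

theorem nodup_edgesBelow_width (hzero : ∀ p x, bit p 0 x) (hK : K ≠ 0) :
    ((edgesBelow K bit (width K n d)).map fun e => s(e.1, e.2)).Nodup := by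
  rw [edgesBelow, List.map_map]
  refine List.Nodup.map_on ?_ ((List.nodup_range.product (nodup_edgeKinds K)).filter _)
  rintro ⟨y, κ⟩ hy ⟨y', κ'⟩ hy' he
  simp only [List.mem_filter, List.mem_product, List.mem_range, decide_eq_true_eq] at hy hy'
  obtain ⟨rfl, hz⟩ := EdgeKind.ends_inj hzero hK hy.2 hy'.2 he
  rw [← labelEquiv_labelAt hy.1.1, hz, labelEquiv_labelAt hy'.1.1]

theorem isEdgeList_edgeList (hzero : ∀ p x, bit p 0 x) (hK : K ≠ 0) :
    IsEdgeList (graph K bit) (edgeList K bit) := by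
  have hinv : ∀ e ∈ edgesBelow K bit (width K n d),
      s(vertexAt (Fin.ofNat (order K n d) (number e.1)),
        vertexAt (Fin.ofNat (order K n d) (number e.2))) = s(e.1, e.2) := by
    intro e he
    have hlt := (mem_edgesBelow_width.1 he).fst_lt
    rw [vertexAt_number hlt.1, vertexAt_number hlt.2]
  have hlink : ∀ {u v}, Link bit (vertexAt u) (vertexAt v) →
      s(u, v) ∈ (edgeList K bit).map fun e => s(e.1, e.2) := by
    intro u v h
    simp only [edgeList, List.map_map, List.mem_map, Function.comp_apply]
    exact ⟨(vertexAt u, vertexAt v), mem_edgesBelow_width.2 h, by simp [number_vertexAt]⟩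
  refine ⟨List.Nodup.of_map (Sym2.map vertexAt) ?_, fun u v => ⟨fun h => ?_, fun h => ?_⟩⟩
  · rw [edgeList, List.map_map, List.map_map]
    convert nodup_edgesBelow_width hzero hK using 1
    exact List.map_congr_left hinv
  · exact (layered_adj.1 h).elim hlink fun h => Sym2.eq_swap ▸ hlink h
  · simp only [edgeList, List.map_map, List.mem_map, Function.comp_apply] at h
    obtain ⟨e, he, h⟩ := h
    have h' := congrArg (Sym2.map vertexAt) h
    simp only [Sym2.map_mk] at h'
    rw [hinv e he] at h'
    have hl := mem_edgesBelow_width.1 he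
    rcases Sym2.eq_iff.1 h' with ⟨e1, e2⟩ | ⟨e1, e2⟩
    · exact layered_adj.2 (.inl (by rwa [← e1, ← e2]))
    · exact layered_adj.2 (.inr (by rwa [← e1, ← e2]))

end Layered

/-! ### Expressions for the edges of the layered graph -/

namespace WordRAM.Expr

/-- The sum of a list of expressions. -/
def sum (l : List Expr) : Expr := l.foldr (· + ·) 0

/-- The product of a list of expressions. -/
def prod (l : List Expr) : Expr := l.foldr (· * ·) 1

instance : Pow Expr ℕ := ⟨fun e q => prod (List.replicate q e)⟩

variable (s : State) (e : Expr)

@[simp] theorem eval_sum (l : List Expr) : (sum l).eval s = (l.map (eval s)).sum := by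
  induction l with
  | nil => rfl
  | cons e l ih => exact congrArg (e.eval s + ·) ih

@[simp] theorem eval_prod (l : List Expr) : (prod l).eval s = (l.map (eval s)).prod := by
  induction l with
  | nil => rfl
  | cons e l ih => exact congrArg (e.eval s * ·) ih

@[simp] theorem eval_pow (q : ℕ) : (e ^ q).eval s = e.eval s ^ q :=
  (eval_prod s _).trans (by simp)

theorem eval_ite_one_ne_zero {c : Prop} [Decidable c] :
    (if c then e else 1).eval s ≠ 0 ↔ (c → e.eval s ≠ 0) := by
  split_ifs with hc <;> simp [hc]

end WordRAM.Expr

namespace Layered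

open Expr

/-- The instance of orthogonal vectors with input `inp`, with an all-ones vector added to each of
the `K + 1` collections as number `0`, and with `K + 1` added coordinates: in the added coordinate
`d + p`, precisely the vectors of collection `p` other than the added one are `0`. -/
def extBit (K n d : ℕ) (inp : ℕ → ℕ) (p : ℕ) (v : Fin (n + 1)) (x : Fin (d + K + 1)) : Prop :=
  (v : ℕ) = 0 ∨ (d ≤ x ∧ (x : ℕ) ≠ d + p) ∨
    ((x : ℕ) < d ∧ inp (2 + ((p * n + (v - 1)) * d + x)) ≠ 0)

/-- The length of the encoding of an instance with `K + 1` collections. -/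
def inputLength (K n d : ℕ) : ℕ := 2 + (K + 1) * n * d

section Expressions

variable (K R : ℕ)

/-- The number of vectors in an extended collection; register `R` holds `n`. -/
def countExpr : Expr := var R + 1

/-- The dimension of the extended instance; register `R + 1` holds `d`. -/
def dimExpr : Expr := var (R + 1) + num (K + 1)

/-- The width of the layered graph. -/
def widthExpr : Expr := countExpr R ^ K * dimExpr K R ^ K

/-- The vector index in position `q` of the label whose number is in register `R + 4`. -/
def vectorExpr (q : ℕ) : Expr := var (R + 4) / dimExpr K R ^ K / countExpr R ^ q % countExpr R

/-- The number of the coordinate half of the label whose number is in register `R + 4`. -/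
def coordsExpr : Expr := var (R + 4) % dimExpr K R ^ K

/-- The coordinate in position `m` of the label whose number is in register `R + 4`. -/
def coordExpr (m : ℕ) : Expr := coordsExpr K R / dimExpr K R ^ m % dimExpr K R

/-- The test `extBit` for the vector `v` of collection `p` and the coordinate `x`. -/
def bitExpr (p : ℕ) (v x : Expr) : Expr :=
  op .eq v 0 + (op .lt (var (R + 1)) (x + 1) * (1 - op .eq x (var (R + 1) + num p)) +
    op .lt x (var (R + 1)) * get (2 + ((num p * var R + (v - 1)) * var (R + 1) + x)))

/-- The test `Consistent`. -/
def consistentExpr (i : ℕ) : Expr :=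
  prod ((List.finRange K).map fun q : Fin K => prod ((List.finRange K).map fun m : Fin K =>
    (if (q : ℕ) < i ∧ q ≤ m then bitExpr R q (vectorExpr K R q) (coordExpr K R m) else 1) *
      if i ≤ q ∧ m ≤ q then bitExpr R (q + 1) (vectorExpr K R q) (coordExpr K R m) else 1))

/-- The test `IsEdgeLabel`. -/
def edgeLabelExpr (l : ℕ) : Expr :=
  if K ≤ l ∧ l ≤ 2 * K then consistentExpr K R (l - K) else op .eq (coordsExpr K R) 0

/-- The number of the label `proj`. -/
def projExpr (l : ℕ) : Expr :=
  (if K < l ∧ l ≤ 2 * K then coordsExpr K R else 0) + dimExpr K R ^ K *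
    sum ((List.finRange K).map fun q : Fin K =>
      if l = 0 ∨ (q : ℕ) + K + 1 = l then 0 else vectorExpr K R q * countExpr R ^ (q : ℕ))

/-- The test `IsProper`. -/
def properExpr (l : ℕ) : Expr :=
  op .eq (projExpr K R l) (var (R + 4)) *
    if K < l ∧ l ≤ 2 * K then consistentExpr K R (l - K) else 1

/-- The number of a vertex in layer `l`. -/
def numberExpr (l : ℕ) (e : Expr) : Expr := num l * widthExpr K R + e

/-- The test `EdgeKind.IsPresent`. -/
def EdgeKind.presentExpr : EdgeKind → Expr
  | layer l => edgeLabelExpr K R l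
  | leaf l => op .eq (properExpr K R l) 0

/-- The numbers of the end points `EdgeKind.ends`. -/
def EdgeKind.endsExpr : EdgeKind → Expr × Expr
  | layer l => (numberExpr K R l (projExpr K R l), numberExpr K R (l + 1) (projExpr K R (l + 1)))
  | leaf l => (0, numberExpr K R l (var (R + 4)))

end Expressions

variable {K R n d : ℕ} {s : State} {inp : ℕ → ℕ}

/-- The registers of `s` contain the size of the instance. -/
structure HoldsSize (R n d : ℕ) (s : State) : Prop where
  count : s.reg R = n
  dim : s.reg (R + 1) = d

namespace HoldsSize

variable (h : HoldsSize R n d s)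
include h

theorem eval_countExpr : (countExpr R).eval s = n + 1 := by
  simp [countExpr, h.count]

theorem eval_dimExpr : (dimExpr K R).eval s = d + K + 1 := by
  simp [dimExpr, h.dim, add_assoc]

theorem eval_widthExpr : (widthExpr K R).eval s = width K (n + 1) (d + K + 1) := by
  simp [widthExpr, h.eval_countExpr, h.eval_dimExpr, width]

theorem eval_bitExpr (hm : ∀ a < inputLength K n d, s.mem a = inp a) {p : ℕ} (hp : p ≤ K)
    {e f : Expr} {v : Fin (n + 1)} {x : Fin (d + K + 1)} (hv : e.eval s = v) (hx : f.eval s = x) :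
    (bitExpr R p e f).eval s ≠ 0 ↔ extBit K n d inp p v x := by
  have haddr : (v : ℕ) ≠ 0 → (x : ℕ) < d →
      2 + ((p * n + (v - 1)) * d + x) < inputLength K n d := by
    intro hv₀ hx
    have hrow : p * n + (v - 1) + 1 ≤ (K + 1) * n := by
      have := v.2
      have := Nat.mul_le_mul_right n hp
      rw [add_mul]
      omega
    have := Nat.mul_le_mul_right d hrow
    rw [add_mul] at this
    simp only [inputLength]
    omega
  simp only [bitExpr, eval_add, eval_mul, eval_sub, eval_lt, eval_eq, eval_num, eval_ofNat,
    eval_var, eval_get, hv, hx, h.count, h.dim, extBit]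
  by_cases hv₀ : (v : ℕ) = 0
  · simp [hv₀]
  by_cases hxd : (x : ℕ) < d
  · rw [hm _ (haddr hv₀ hxd)]
    simp [hv₀, hxd, show ¬ d ≤ x by omega, show ¬ d < (x : ℕ) + 1 by omega]
  · by_cases hxp : (x : ℕ) = d + p
    · simp [hv₀, hxp]
    · simp [hv₀, hxd, hxp, show d ≤ x by omega, show d < (x : ℕ) + 1 by omega]

variable {z : Label K (n + 1) (d + K + 1)} (hz : s.reg (R + 4) = labelEquiv z)
include hz

theorem eval_vectorExpr (q : Fin K) : (vectorExpr K R q).eval s = z.1 q := by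
  simp [vectorExpr, h.eval_countExpr, h.eval_dimExpr, hz, coe_fst_apply z]

theorem eval_coordsExpr :
    (coordsExpr K R).eval s = ∑ q, (z.2 q : ℕ) * (d + K + 1) ^ (q : ℕ) := by
  simp [coordsExpr, h.eval_dimExpr, hz, sum_snd_eq_mod]

theorem eval_coordExpr (m : Fin K) : (coordExpr K R m).eval s = z.2 m := by
  simp [coordExpr, coordsExpr, h.eval_dimExpr, hz, coe_snd_apply z]

theorem eval_consistentExpr (hm : ∀ a < inputLength K n d, s.mem a = inp a) (i : ℕ) :
    (consistentExpr K R i).eval s ≠ 0 ↔ Consistent (extBit K n d inp) i z := by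
  have hbit (q m : Fin K) {p : ℕ} (hp : p ≤ K) :=
    h.eval_bitExpr hm hp (h.eval_vectorExpr hz q) (h.eval_coordExpr hz m)
  simp only [consistentExpr, Consistent, eval_prod, ne_eq, List.prod_eq_zero_iff, List.map_map,
    List.mem_map, List.mem_finRange, true_and, Function.comp_apply, not_exists]
  refine forall_congr' fun q => forall_congr' fun m => ?_
  rw [eval_mul, mul_eq_zero, not_or, ← ne_eq, ← ne_eq, eval_ite_one_ne_zero, eval_ite_one_ne_zero,
    hbit q m q.2.le, hbit q m (p := q + 1) q.2, and_imp, and_imp]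

theorem eval_edgeLabelExpr (hm : ∀ a < inputLength K n d, s.mem a = inp a) (l : ℕ) :
    (edgeLabelExpr K R l).eval s ≠ 0 ↔ IsEdgeLabel (extBit K n d inp) l z := by
  unfold edgeLabelExpr IsEdgeLabel
  split_ifs
  · exact h.eval_consistentExpr hz hm _
  · simp [h.eval_coordsExpr hz, funext_iff]

theorem eval_projExpr (l : ℕ) : (projExpr K R l).eval s = labelEquiv (proj l z) := by
  rw [coe_labelEquiv, projExpr, eval_add, eval_mul, eval_sum, eval_pow, h.eval_dimExpr,
    List.map_map, ← Fin.sum_univ_def]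
  simp only [proj, Function.comp_apply]
  congr 2
  · split_ifs
    · exact h.eval_coordsExpr hz
    · simp
  · refine Finset.sum_congr rfl fun q _ => ?_
    split_ifs
    · simp
    · simp [h.eval_vectorExpr hz, h.eval_countExpr]

theorem eval_properExpr (hm : ∀ a < inputLength K n d, s.mem a = inp a) (l : ℕ) :
    (properExpr K R l).eval s ≠ 0 ↔ IsProper (extBit K n d inp) (l, z) := by
  rw [properExpr, IsProper, eval_mul, mul_ne_zero_iff, eval_eq, h.eval_projExpr hz, eval_var, hz,
    eval_ite_one_ne_zero, h.eval_consistentExpr hz hm, and_imp]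
  simp [Fin.val_inj]

theorem eval_presentExpr (hm : ∀ a < inputLength K n d, s.mem a = inp a) (κ : EdgeKind) :
    (κ.presentExpr K R).eval s ≠ 0 ↔ κ.IsPresent (extBit K n d inp) z := by
  cases κ with
  | layer l => exact h.eval_edgeLabelExpr hz hm l
  | leaf l =>
    rw [EdgeKind.IsPresent, ← h.eval_properExpr hz hm]
    by_cases hp : (properExpr K R l).eval s = 0 <;> simp [EdgeKind.presentExpr, hp]

theorem eval_endsExpr (κ : EdgeKind) :
    (κ.endsExpr K R).1.eval s = number (κ.ends z).1 ∧
      (κ.endsExpr K R).2.eval s = number (κ.ends z).2 := by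
  cases κ <;> simp [EdgeKind.endsExpr, EdgeKind.ends, numberExpr, number, h.eval_widthExpr,
    h.eval_projExpr hz, hz, labelEquiv_zero]

end HoldsSize

end Layered

/-! ### The program that writes the layered graph -/

namespace WordRAM

/-- The memory that contains the list `l` from cell `0` on. -/
def memOfList (l : List ℕ) (a : ℕ) : ℕ := l.getD a 0

theorem memOfList_append_left {l l' : List ℕ} {a : ℕ} (ha : a < l.length) :
    memOfList (l ++ l') a = memOfList l a :=
  List.getD_append _ _ _ _ ha

theorem memOfList_append_right (l l' : List ℕ) (a : ℕ) :
    memOfList (l ++ l') (l.length + a) = memOfList l' a := by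
  rw [memOfList, List.getD_append_right _ _ _ _ (Nat.le_add_right _ _), Nat.add_sub_cancel_left,
    memOfList]

theorem memOfList_le {l : List ℕ} {B : ℕ} (h : ∀ x ∈ l, x ≤ B) (a : ℕ) : memOfList l a ≤ B := by
  rw [memOfList, List.getD_eq_getElem?_getD]
  cases ha : l[a]? with
  | none => exact Nat.zero_le B
  | some x => exact h x (List.mem_of_getElem? ha)

theorem update_memOfList_length (l : List ℕ) (v : ℕ) :
    Function.update (memOfList l) l.length v = memOfList (l ++ [v]) := by
  funext a
  rcases lt_trichotomy a l.length with ha | rfl | ha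
  · rw [Function.update_of_ne ha.ne, memOfList_append_left ha]
  · simp [memOfList]
  · rw [Function.update_of_ne ha.ne', memOfList, memOfList, List.getD_eq_default _ _ ha.le,
      List.getD_eq_default _ _ (by simpa using ha)]

theorem update_memOfList {l : List ℕ} {a : ℕ} (ha : a < l.length) (v : ℕ) :
    Function.update (memOfList l) a v = memOfList (l.set a v) := by
  funext c
  rcases eq_or_ne c a with rfl | hc
  · simp [memOfList, ha]
  · simp [memOfList, hc, hc.symm, List.getD_eq_getElem?_getD]

end WordRAM

namespace Layered

open Expr Cmd

/-- Write the value of `e` into the cell with address in register `R + 3` and move on by one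
cell. -/
def emit (R : ℕ) (e : Expr) : Cmd :=
  .seq (.write (var (R + 3)) e) (.assign (R + 3) (var (R + 3) + 1))

/-- Write the edge of the given kind with the label in register `R + 4`, if there is one. -/
def emitEdge (K R : ℕ) (κ : EdgeKind) : Cmd :=
  .when (κ.presentExpr K R) (.seq (emit R (κ.endsExpr K R).1) (emit R (κ.endsExpr K R).2))

/-- Write all edges of the given kinds with the label in register `R + 4`. -/
def emitEdges (K R : ℕ) (ks : List EdgeKind) : Cmd :=
  ks.foldr (fun κ c => .seq (emitEdge K R κ) c) .skip

/-- Read the size of the instance of orthogonal vectors and compute the first address behind it,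
both for the address of the graph (register `R + 2`) and for the next address to write to. -/
def readSize (K R : ℕ) : Cmd :=
  .seq (.assign R (get 0)) <| .seq (.assign (R + 1) (get 1)) <|
  .seq (.assign (R + 2) (2 + num (K + 1) * var R * var (R + 1))) <|
  .assign (R + 3) (var (R + 2))

/-- Write the encoding of the numbered layered graph behind the instance of orthogonal vectors. The
number of edges is filled in at the end. -/
def writeGraph (K R : ℕ) : Cmd :=
  .seq (readSize K R) <|
  .seq (emit R (num (3 * K + 2) * widthExpr K R)) <| .seq (emit R 0) <|
  .seq (.loop (R + 4) (widthExpr K R) (emitEdges K R (edgeKinds K))) <|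
  .write (var (R + 2) + 1) ((var (R + 3) - var (R + 2) - 2) / 2)

/-- The encoding of a list of edges. -/
def vertexPairs {K n d : ℕ} (es : List (Vertex K n d × Vertex K n d)) : List ℕ :=
  es.flatMap fun e => [number e.1, number e.2]

theorem length_vertexPairs {K n d : ℕ} (es : List (Vertex K n d × Vertex K n d)) :
    (vertexPairs es).length = 2 * es.length := by
  simp [vertexPairs, mul_comm]

/-- The list `l` has been written behind the instance `inp` of orthogonal vectors. -/
structure Writing (R n d : ℕ) (inp l : List ℕ) (s : State) : Prop extends HoldsSize R n d s where
  base : s.reg (R + 2) = inp.length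
  next : s.reg (R + 3) = (inp ++ l).length
  flag : s.reg (R + 5) = 0
  reg_eq_zero : ∀ r < R, s.reg r = 0
  mem_eq : s.mem = memOfList (inp ++ l)

variable {K R n d B N : ℕ} {inp l : List ℕ} {s : State} {Q : State → Prop}

theorem Writing.setReg_label (h : Writing R n d inp l s) (y : ℕ) :
    Writing R n d inp l (s.setReg (R + 4) y) := by
  obtain ⟨⟨hcount, hdim⟩, hbase, hnext, hflag, hreg, hmem⟩ := h
  refine ⟨⟨?_, ?_⟩, ?_, ?_, ?_, fun r hr => ?_, hmem⟩
  case refine_6 => exact (Function.update_of_ne (by omega) _ _).trans (hreg r hr)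
  all_goals simp [State.setReg, *]

theorem Writing.wp_emit {e : Expr} {v : ℕ} (h : Writing R n d inp l s) (hv : e.eval s = v)
    (hvB : v ≤ B) (hroom : (inp ++ l).length + 1 ≤ B)
    (hQ : ∀ s', Writing R n d inp (l ++ [v]) s' → s'.reg (R + 4) = s.reg (R + 4) → Q s') :
    (emit R e).wp B N Q s := by
  obtain ⟨⟨hcount, hdim⟩, hbase, hnext, hflag, hreg, hmem⟩ := h
  refine ⟨hv.trans_le hvB, ?_, hQ _ ⟨⟨?_, ?_⟩, ?_, ?_, ?_, fun r hr => ?_, ?_⟩ ?_⟩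
  case refine_7 =>
    simp only [State.setMem, State.setReg]
    rw [Function.update_of_ne (by omega), hreg r hr]
  case refine_8 =>
    simp [State.setMem, State.setReg, hv, hnext, hmem, ← update_memOfList_length,
      ← List.append_assoc]
  all_goals simp_all [State.setMem, State.setReg, add_assoc]

section Instance

variable {z : Label K (n + 1) (d + K + 1)}

open Classical in
theorem Writing.wp_emitEdges (hlen : inp.length = inputLength K n d) (ks : List EdgeKind)
    (hends : ∀ κ ∈ ks, number (κ.ends z).1 ≤ B ∧ number (κ.ends z).2 ≤ B) {l : List ℕ} {s : State}
    (h : Writing R n d inp l s) (hz : s.reg (R + 4) = labelEquiv z)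
    (hroom : (inp ++ l).length + 2 * ks.length ≤ B)
    (hQ : ∀ s', Writing R n d inp (l ++ vertexPairs ((ks.filter fun κ =>
      κ.IsPresent (extBit K n d (memOfList inp)) z).map fun κ => κ.ends z)) s' → Q s') :
    (emitEdges K R ks).wp B N Q s := by
  induction ks generalizing l s with
  | nil => exact hQ s (by simpa [vertexPairs] using h)
  | cons κ ks ih =>
    simp only [List.forall_mem_cons] at hends
    simp only [List.length_cons, List.length_append] at hroom
    have hpresent := h.eval_presentExpr hz (inp := memOfList inp)
      (fun a ha => by rw [h.mem_eq, memOfList_append_left (by omega)]) κ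
    have hκ := h.eval_endsExpr hz κ
    refine ⟨fun hne => ?_, fun heq => ?_⟩
    · refine h.wp_emit hκ.1 hends.1.1 (by rw [List.length_append]; omega) fun s₁ h₁ hz₁ => ?_
      refine h₁.wp_emit (h₁.eval_endsExpr (hz₁.trans hz) κ).2 hends.1.2
        (by simp only [List.length_append, List.length_singleton]; omega) fun s₂ h₂ hz₂ => ?_
      refine ih hends.2 h₂ (hz₂.trans (hz₁.trans hz))
        (by simp only [List.length_append, List.length_singleton]; omega) fun s' h' => hQ s' ?_
      rw [List.filter_cons_of_pos (by simpa using hpresent.1 hne)]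
      simpa [vertexPairs] using h'
    · refine ih hends.2 h hz (by rw [List.length_append]; omega) fun s' h' => hQ s' ?_
      rwa [List.filter_cons_of_neg (by simpa using mt hpresent.2 (not_not.2 heq))]

end Instance

section Edges

variable {n d : ℕ} [NeZero n] [NeZero d] {bit : ℕ → Fin n → Fin d → Prop}

open Classical in
theorem edgesBelow_succ (y : ℕ) : edgesBelow K bit (y + 1) = edgesBelow K bit y ++
    ((edgeKinds K).filter fun κ => κ.IsPresent bit (labelAt y : Label K n d)).map
      fun κ => κ.ends (labelAt y) := by
  simp only [edgesBelow, List.range_succ, SProd.sprod, List.product, List.flatMap_append,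
    List.flatMap_singleton, List.filter_append, List.map_append, List.filter_map, List.map_map]
  rfl

theorem graphInput_edgeList : graphInput (edgeList K bit) =
    order K n d :: (edgesBelow K bit (width K n d)).length ::
      vertexPairs (edgesBelow K bit (width K n d)) := by
  simp only [graphInput, edgeList, List.length_map, List.flatMap_map, vertexPairs]
  congr 2
  refine List.flatMap_congr fun e he => ?_
  have hlt := (mem_edgesBelow_width.1 he).fst_lt
  simp [Nat.mod_eq_of_lt (number_lt hlt.1), Nat.mod_eq_of_lt (number_lt hlt.2)]

theorem EdgeKind.number_ends_le {κ : EdgeKind} (hκ : κ ∈ edgeKinds K) (z : Label K n d) :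
    number (κ.ends z).1 ≤ order K n d ∧ number (κ.ends z).2 ≤ order K n d := by
  cases κ with
  | layer l =>
    have hl : l < 3 * K + 1 := by simpa [edgeKinds] using hκ
    exact ⟨(number_lt (p := (l, proj l z)) (by simp only; omega)).le,
      (number_lt (p := (l + 1, proj (l + 1) z)) (by simp only; omega)).le⟩
  | leaf l =>
    have hl : l < 3 * K + 2 := by simpa [edgeKinds] using hκ
    exact ⟨(number_lt (p := (0, 0)) (by simp only; omega)).le, (number_lt (p := (l, z)) hl).le⟩

end Edges

/-- The instance and the encoding of the layered graph fit into the first `B` memory cells. -/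
def Room (K n d B : ℕ) : Prop := inputLength K n d + 4 * order K (n + 1) (d + K + 1) + 2 ≤ B

theorem Writing.wp_loop_emitEdges (hlen : inp.length = inputLength K n d) (hB : Room K n d B)
    (hN : width K (n + 1) (d + K + 1) ≤ N) {x y : ℕ} (h : Writing R n d inp [x, y] s)
    (hQ : ∀ s', Writing R n d inp (x :: y :: vertexPairs (edgesBelow K
      (extBit K n d (memOfList inp)) (width K (n + 1) (d + K + 1)))) s' → Q s') :
    (Cmd.loop (R + 4) (widthExpr K R) (emitEdges K R (edgeKinds K))).wp B N Q s := by
  have hwidth := h.eval_widthExpr (K := K)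
  refine ⟨hwidth.trans_le hN, fun i => Writing R n d inp
    (x :: y :: vertexPairs (edgesBelow K (extBit K n d (memOfList inp)) i)), ?_, ?_, ?_⟩
  · simpa [vertexPairs, edgesBelow] using h
  · intro i hi s' h'
    rw [hwidth] at hi
    refine (h'.setReg_label i).wp_emitEdges (z := labelAt i) hlen _ (fun κ hκ => ?_)
      ((Function.update_self ..).trans (labelEquiv_labelAt hi).symm) ?_ fun s'' h'' => ?_
    · have hle := EdgeKind.number_ends_le hκ (labelAt i : Label K (n + 1) (d + K + 1))
      unfold Room at hB
      exact ⟨by omega, by omega⟩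
    · have hle : (edgesBelow K (extBit K n d (memOfList inp)) i).length + (6 * K + 3) ≤
          2 * order K (n + 1) (d + K + 1) :=
        calc _ ≤ (i + 1) * (6 * K + 3) := by
              rw [add_one_mul i]
              exact Nat.add_le_add_right (length_edgesBelow_le i) _
          _ ≤ width K (n + 1) (d + K + 1) * (2 * (3 * K + 2)) := Nat.mul_le_mul hi (by omega)
          _ = 2 * order K (n + 1) (d + K + 1) := by rw [order]; ring
      unfold Room at hB
      simp only [List.length_append, List.length_cons, length_vertexPairs, length_edgeKinds, hlen]
      omega
    · beta_reduce
      rw [edgesBelow_succ]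
      simpa [vertexPairs] using h''
  · intro s' h'
    exact hQ s' (hwidth ▸ h')

theorem Writing.wp_write_count {m x y : ℕ} {es : List ℕ}
    (h : Writing R n d inp (x :: y :: es) s) (hes : es.length = 2 * m) (hm : m ≤ B)
    (hQ : ∀ s', Writing R n d inp (x :: m :: es) s' → Q s') :
    (Cmd.write (var (R + 2) + 1) ((var (R + 3) - var (R + 2) - 2) / 2)).wp B N Q s := by
  obtain ⟨⟨hcount, hdim⟩, hbase, hnext, hflag, hreg, hmem⟩ := h
  have hval : (((var (R + 3) - var (R + 2) - 2) / 2 : Expr)).eval s = m := by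
    simp only [eval_div, eval_sub, eval_var, eval_ofNat, hbase, hnext, List.length_append,
      List.length_cons, hes]
    omega
  refine ⟨hval.trans_le hm, hQ _ ⟨⟨hcount, hdim⟩, hbase, by simpa [State.setMem] using hnext,
    hflag, hreg, ?_⟩⟩
  simp only [State.setMem, hval, hmem, eval_add, eval_var, eval_ofNat, hbase]
  rw [update_memOfList (by simp), List.set_append_right _ _ (Nat.le_add_right _ _)]
  simp

theorem wp_readSize (hlen : inp.length = inputLength K n d) (hB : inputLength K n d ≤ B)
    (hn : memOfList inp 0 = n) (hd : memOfList inp 1 = d) (hle : ∀ a, memOfList inp a ≤ B)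
    (hQ : ∀ s', Writing R n d inp [] s' → Q s') :
    (readSize K R).wp B N Q (State.start inp) := by
  have hbase : 2 + (K + 1) * n * d = inp.length := hlen.symm
  have hstart : (State.start inp).mem = memOfList inp := rfl
  rw [← hlen] at hB
  refine ⟨hle _, hle _, ?_, ?_, hQ _ ⟨⟨?_, ?_⟩, ?_, ?_, ?_, fun r hr => ?_, ?_⟩⟩
  case refine_8 =>
    simp only [State.setReg]
    iterate 4 rw [Function.update_of_ne (by omega)]
    rfl
  all_goals simp [State.setReg, hstart, hn, hd, hbase, hB]
  rfl

theorem wp_writeGraph (hlen : inp.length = inputLength K n d) (hB : Room K n d B)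
    (hN : width K (n + 1) (d + K + 1) ≤ N) (hn : memOfList inp 0 = n) (hd : memOfList inp 1 = d)
    (hle : ∀ a, memOfList inp a ≤ B) (hQ : ∀ s', Writing R n d inp
      (graphInput (edgeList K (extBit K n d (memOfList inp)))) s' → Q s') :
    (writeGraph K R).wp B N Q (State.start inp) := by
  have hroom : inp.length + 4 * order K (n + 1) (d + K + 1) + 2 ≤ B := by rwa [hlen]
  have hedges := length_edgeList_le (K := K) (n := n + 1) (d := d + K + 1)
    (bit := extBit K n d (memOfList inp))
  rw [edgeList, List.length_map] at hedges
  refine wp_readSize hlen (by omega) hn hd hle fun s₁ h₁ => ?_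
  refine h₁.wp_emit (v := order K (n + 1) (d + K + 1)) ?_ (by omega)
    (by rw [List.append_nil]; omega) fun s₂ h₂ _ => ?_
  · rw [eval_mul, eval_num, h₁.eval_widthExpr, order]
  refine h₂.wp_emit rfl (Nat.zero_le B)
    (by simp only [List.length_append, List.nil_append, List.length_singleton]; omega)
    fun s₃ h₃ _ => h₃.wp_loop_emitEdges hlen hB hN fun s₄ h₄ => ?_
  exact h₄.wp_write_count (length_vertexPairs _) (by omega)
    fun s' h' => hQ s' (by rwa [graphInput_edgeList])

end Layered

/-! ### The reduction -/

namespace Layered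

open Expr Cmd

/-- Write into cell `0` whether one of the outputs at the sources is larger than `θ`. The address of
the outputs is in register `R + 2`, and register `R + 5` collects the answer. -/
def scan (K R θ : ℕ) : Cmd :=
  .seq (.loop (R + 4) (countExpr R ^ K) (.when (op .lt (num θ) (get (var (R + 2) +
    (num K * widthExpr K R + var (R + 4) * dimExpr K R ^ K)))) (.assign (R + 5) 1))) <|
  .write 0 (var (R + 5))

/-- The algorithm for orthogonal vectors obtained from an algorithm `p` on graphs: run `p` on the
layered graph, with the registers from `p.regBound` on in use by the reduction, and compare the
outputs at the sources with `θ`. -/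
def reduction (K θ : ℕ) (p : Prog) : Prog :=
  let write := writeGraph K p.regBound
  let scan := scan K p.regBound θ
  let t := max (p.regBound + 6) (max write.regBound scan.regBound)
  .seq (write.compile t) (.seq (p.relocate (p.regBound + 2) t) (scan.compile t))

variable {K R n d θ B N v w b : ℕ} {inp : List ℕ} {o : ℕ → ℕ} {s u : State}

theorem coe_source [NeZero n] [NeZero d] (a : Fin K → Fin n) :
    (source K n d a : ℕ) = K * width K n d + finFunctionFinEquiv a * d ^ K := by
  rw [source, Fin.val_ofNat, Nat.mod_eq_of_lt (number_lt (by simp only; omega)), number,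
    coe_labelEquiv, finFunctionFinEquiv_apply]
  simp [mul_comm]

theorem exists_source_iff [NeZero n] [NeZero d] {P : ℕ → Prop} :
    (∃ a, P (source K n d a)) ↔ ∃ j < n ^ K, P (K * width K n d + j * d ^ K) := by
  constructor
  · rintro ⟨a, ha⟩
    exact ⟨finFunctionFinEquiv a, Fin.is_lt _, by rwa [← coe_source]⟩
  · rintro ⟨j, hj, hP⟩
    exact ⟨finFunctionFinEquiv.symm ⟨j, hj⟩, by rwa [coe_source, Equiv.apply_symm_apply]⟩

/-- The output `o` of the algorithm on graphs is in the memory from cell `b` on. -/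
structure HoldsOutput (R n d b : ℕ) (o : ℕ → ℕ) (s : State) : Prop extends HoldsSize R n d s where
  base : s.reg (R + 2) = b
  flag : s.reg (R + 5) = 0
  mem_eq : ∀ a, s.mem (b + a) = o a

theorem HoldsOutput.wp_scan (h : HoldsOutput R n d b o s) (hN : (n + 1) ^ K ≤ N) (hB : 1 ≤ B) :
    (scan K R θ).wp B N
      (fun s' => s'.mem 0 ≠ 0 ↔ ∃ a, θ < o (source K (n + 1) (d + K + 1) a)) s := by
  classical
  obtain ⟨hsize, hbase, hflag, hmem⟩ := h
  let hit (j : ℕ) : Prop := θ < o (K * width K (n + 1) (d + K + 1) + j * (d + K + 1) ^ K)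
  have hcount : (countExpr R ^ K).eval s = (n + 1) ^ K := by rw [eval_pow, hsize.eval_countExpr]
  refine ⟨hcount.trans_le hN, fun i s' => HoldsSize R n d s' ∧ s'.reg (R + 2) = b ∧
    s'.mem = s.mem ∧ s'.reg (R + 5) = if ∃ j < i, hit j then 1 else 0,
    ⟨hsize, hbase, rfl, by simpa using hflag⟩, ?_, ?_⟩
  · rintro i - s' ⟨hsize', hbase', hmem', hflag'⟩
    have hlabel : HoldsSize R n d (s'.setReg (R + 4) i) :=
      ⟨by simpa [State.setReg] using hsize'.count, by simpa [State.setReg] using hsize'.dim⟩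
    have htest : (op .lt (num θ) (get (var (R + 2) + (num K * widthExpr K R +
        var (R + 4) * dimExpr K R ^ K)))).eval (s'.setReg (R + 4) i) = if hit i then 1 else 0 := by
      simp only [eval_lt, eval_num, eval_get, eval_add, eval_mul, eval_pow, eval_var,
        hlabel.eval_widthExpr, hlabel.eval_dimExpr]
      simp [State.setReg, hbase', hmem', hmem, hit]
    simp only [Cmd.wp, htest, eval_ofNat, Nat.exists_lt_succ_right]
    refine ⟨fun hi => ⟨hB, ⟨?_, ?_⟩, ?_, hmem', ?_⟩, fun hi => ⟨hlabel, ?_, hmem', ?_⟩⟩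
    all_goals simp_all [State.setReg, hsize'.count, hsize'.dim]
  · rintro s' ⟨-, -, -, hflag'⟩
    rw [hcount] at hflag'
    rw [Cmd.wp, exists_source_iff (P := fun y => θ < o y)]
    simp only [eval_var, eval_ofNat, hflag', State.setMem, Function.update_self]
    change _ ∧ (_ ↔ ∃ j < (n + 1) ^ K, hit j)
    split_ifs with hj <;> simp [hj, hB]

theorem pow_le_order : (n + 1) ^ K ≤ order K (n + 1) (d + K + 1) :=
  (Nat.le_mul_of_pos_right _ (by positivity)).trans (Nat.le_mul_of_pos_left _ (by omega))

theorem HoldsOutput.halts_scan {t m : ℕ} (h : HoldsOutput R n d b o s) (hs : Models t B s s)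
    (hB : 2 ≤ B) (hN : order K (n + 1) (d + K + 1) ≤ B) (hw : B ^ m < 2 ^ w) (hBw : B + 1 < 2 ^ w)
    (hm : (scan K R θ).exprSize ≤ m) (ht : (scan K R θ).regBound ≤ t) :
    Halts w ((scan K R θ).compile t) ((scan K R θ).cost 1 * order K (n + 1) (d + K + 1)) s
      fun s' => s'.mem 0 ≠ 0 ↔ ∃ a, θ < o (source K (n + 1) (d + K + 1) a) := by
  refine ((scan K R θ).sound hB hN hw hBw ht hm t le_rfl _ _ _ hs
    (h.wp_scan pow_le_order (by omega))).mono ?_ ?_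
  · exact (cost_le NeZero.one_le _).trans_eq (by simp [scan, depth])
  · rintro s' ⟨⟨s'', hs'', hmodels⟩, -⟩
    exact hmodels.mem_eq ▸ hs''

theorem depth_emitEdges (ks : List EdgeKind) : (emitEdges K R ks).depth = 0 := by
  unfold emitEdges
  induction ks with
  | nil => rfl
  | cons κ ks ih => simpa [emitEdge, emit, depth] using ih

theorem halts_writeGraph {t m : ℕ} (hlen : inp.length = inputLength K n d) (hB : Room K n d B)
    (hn : memOfList inp 0 = n) (hd : memOfList inp 1 = d) (hle : ∀ a, memOfList inp a ≤ B)
    (hw : B ^ m < 2 ^ w) (hBw : B + 1 < 2 ^ w) (hm : (writeGraph K R).exprSize ≤ m)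
    (ht : (writeGraph K R).regBound ≤ t) :
    Halts w ((writeGraph K R).compile t)
      ((writeGraph K R).cost 1 * order K (n + 1) (d + K + 1)) (State.start inp)
      fun u => ∃ s, Writing R n d inp (graphInput (edgeList K (extBit K n d (memOfList inp)))) s ∧
        Models t B s u := by
  have hroom := hB
  unfold Room inputLength at hroom
  have hone : 1 ≤ order K (n + 1) (d + K + 1) := NeZero.one_le
  have hwidth : width K (n + 1) (d + K + 1) ≤ order K (n + 1) (d + K + 1) :=
    Nat.le_mul_of_pos_left _ (by omega)
  have hstart : Models t B (State.start inp) (State.start inp) :=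
    ⟨fun _ _ => rfl, rfl, fun _ _ => Nat.zero_le B, hle⟩
  refine ((writeGraph K R).sound (N := order K (n + 1) (d + K + 1)) (by omega) (by omega) hw hBw ht
    hm t le_rfl _ _ _ hstart (wp_writeGraph hlen hB hwidth hn hd hle fun _ => id)).mono
    ?_ fun u hu => hu.1
  exact (cost_le hone _).trans_eq (by simp [writeGraph, readSize, emit, depth_emitEdges, depth])

theorem Writing.halts_relocate {p : Prog} {g : List ℕ} {t k : ℕ} {s' : State}
    (h : Writing p.regBound n d inp g s) (hu : Models t B s u) (ht : p.regBound + 6 ≤ t)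
    (hv : 2 ^ v ≤ B) (hw : 2 ^ v + inp.length ≤ 2 ^ w) (hrun : Exec v p (State.start g) k s') :
    Halts w (p.relocate (p.regBound + 2) t) (2 * k) u fun u' =>
      HoldsOutput p.regBound n d inp.length s'.mem u' ∧ Models t B u' u' := by
  obtain ⟨⟨hcount, hdim⟩, hbase, -, hflag, hreg, hmem⟩ := h
  have hzero : ∀ r, (State.start g).reg r < 2 ^ v := fun _ => Nat.two_pow_pos v
  have hcell (a : ℕ) : u.mem (inp.length + a) = (State.start g).mem a := by
    rw [hu.mem_eq, hmem, memOfList_append_right]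
    rfl
  have hrep : Represents p.regBound t inp.length u (State.start g) u :=
    ⟨fun r hr => (hu.reg_eq r (by omega)).trans (hreg r hr), fun _ _ _ => rfl, hcell,
      fun _ _ => rfl⟩
  obtain ⟨k', u', hexec, hk', hrep'⟩ := hrun.relocate hw (Nat.le_add_right _ 2) (by omega)
    (by omega) ((hu.reg_eq _ (by omega)).trans hbase) le_rfl hzero u hrep
  have hframe : ∀ r, p.regBound ≤ r → r < t → u'.reg r = s.reg r := fun r hr hrt =>
    (hrep'.reg_frame r hr hrt.ne).trans (hu.reg_eq r hrt)
  refine ⟨k', hk', u', hexec, ⟨⟨?_, ?_⟩, ?_, ?_, hrep'.mem_eq⟩, fun _ _ => rfl, rfl,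
    fun r hr => ?_, fun a => ?_⟩
  · rw [hframe _ (by omega) (by omega), hcount]
  · rw [hframe _ (by omega) (by omega), hdim]
  · rw [hframe _ (by omega) (by omega), hbase]
  · rw [hframe _ (by omega) (by omega), hflag]
  · by_cases hrp : r < p.regBound
    · rw [hrep'.reg_eq r hrp]
      exact (hrun.reg_lt hzero r).le.trans hv
    · rw [hframe r (by omega) hr]
      exact hu.reg_le r hr
  · by_cases ha : a < inp.length
    · rw [hrep'.mem_frame a ha, hu.mem_eq]
      exact hu.mem_le a
    · obtain ⟨c, rfl⟩ := Nat.exists_eq_add_of_le (not_lt.1 ha)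
      rw [hrep'.mem_eq]
      exact Nat.le_of_lt_succ (hrun.mem_lt (by omega) hzero
        (fun c => Nat.lt_succ_of_le (hcell c ▸ hu.mem_eq ▸ hu.mem_le _)) c)

/-- The exponent of the word size that the reduction needs: with words up to `B`, its intermediate
results are at most `B ^ reductionSize K θ p`. -/
def reductionSize (K θ : ℕ) (p : Prog) : ℕ :=
  (writeGraph K p.regBound).exprSize + (scan K p.regBound θ).exprSize + 2

theorem runsWithin_reduction {p : Prog} {T : ℝ} {Q : (ℕ → ℕ) → Prop}
    (hlen : inp.length = inputLength K n d) (hn : memOfList inp 0 = n) (hd : memOfList inp 1 = d)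
    (hle : ∀ a, memOfList inp a ≤ B)
    (hB : 2 ^ v + (inputLength K n d + 4 * order K (n + 1) (d + K + 1) + 2) ≤ B)
    (hw : B ^ reductionSize K θ p < 2 ^ w)
    (hrun : RunsWithin p v (graphInput (edgeList K (extBit K n d (memOfList inp)))) T Q) :
    RunsWithin (reduction K θ p) w inp
      (((writeGraph K p.regBound).cost 1 + (scan K p.regBound θ).cost 1 : ℕ) *
        order K (n + 1) (d + K + 1) + 2 * T)
      fun out => ∃ o, Q o ∧ (out 0 ≠ 0 ↔ ∃ a, θ < o (source K (n + 1) (d + K + 1) a)) := by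
  obtain ⟨k, s', hexec, hkT, hQ⟩ := hrun
  have hpos := Nat.two_pow_pos v
  have hroom : Room K n d B := by unfold Room; omega
  have htwo : 2 ≤ B := by omega
  have hBw : B + 1 < 2 ^ w := by
    have hsq : B ^ 2 ≤ B ^ reductionSize K θ p :=
      Nat.pow_le_pow_right (by omega) (Nat.le_add_left _ _)
    nlinarith only [hsq, hw, htwo]
  obtain ⟨l, hl, u, hu, hans⟩ := (halts_writeGraph (R := p.regBound)
    (t := max (p.regBound + 6) (max (writeGraph K p.regBound).regBound
      (scan K p.regBound θ).regBound)) hlen hroom hn hd hle hw hBw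
    (by unfold reductionSize; omega) (by omega)).seq fun u ⟨s, hs, hus⟩ =>
    (hs.halts_relocate hus (le_max_left _ _) (by omega) (by omega) hexec).seq fun u' ⟨hout, hu'⟩ =>
      hout.halts_scan (K := K) (θ := θ) hu' htwo (by omega) hw hBw (by unfold reductionSize; omega)
        (by omega)
  refine ⟨l, u, hu, ?_, s'.mem, hQ, hans⟩
  have hsum : (l : ℝ) ≤ ((writeGraph K p.regBound).cost 1 * order K (n + 1) (d + K + 1) +
      (2 * k + (scan K p.regBound θ).cost 1 * order K (n + 1) (d + K + 1)) : ℕ) := mod_cast hl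
  push_cast at hsum ⊢
  linarith

end Layered

/-! ### The encoding of orthogonal vectors instances -/

section Encoding

theorem length_flatMap_const {α : Type*} {f : α → List ℕ} {m : ℕ} (hf : ∀ x, (f x).length = m)
    (l : List α) : (l.flatMap f).length = l.length * m := by
  simp [List.length_flatMap, hf]

theorem getD_flatMap_const {α : Type*} {f : α → List ℕ} {m : ℕ} (hf : ∀ x, (f x).length = m) :
    ∀ (l : List α) (i : Fin l.length) {j : ℕ}, j < m →
      (l.flatMap f).getD (i * m + j) 0 = (f l[i]).getD j 0
  | [], i, _, _ => i.elim0
  | x :: l, ⟨0, _⟩, j, hj => by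
    rw [List.flatMap_cons, List.getD_append _ _ _ _ (by simp [hf, hj])]
    simp
  | x :: l, ⟨i + 1, hi⟩, j, hj => by
    have ih := getD_flatMap_const hf l ⟨i, by simpa using hi⟩ hj
    have hindex : (i + 1) * m + j = m + (i * m + j) := by ring
    simp only at ih
    rw [List.flatMap_cons, List.getD_append_right _ _ _ _ (by simp [hf, hindex])]
    simp only [hf, hindex, Nat.add_sub_cancel_left, ih]
    rfl

variable {k n d : ℕ} (A : Fin k → Fin n → Fin d → Bool)

theorem length_ovInput : (ovInput A).length = 2 + k * n * d := by
  have hrow (i : Fin k) : ((List.finRange n).flatMap fun j =>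
      (List.finRange d).map fun l => (A i j l).toNat).length = n * d := by
    rw [length_flatMap_const (m := d)] <;> simp
  rw [ovInput, List.length_cons, List.length_cons, length_flatMap_const hrow, List.length_finRange]
  ring

theorem getD_ovInput (i : Fin k) (j : Fin n) (l : Fin d) :
    (ovInput A).getD (2 + ((i * n + j) * d + l)) 0 = (A i j l).toNat := by
  have hindex : 2 + ((i * n + j) * d + (l : ℕ)) = i * (n * d) + (j * d + l) + 1 + 1 := by ring
  have hjl : (j : ℕ) * d + l < n * d := by
    nlinarith only [j.2, l.2, Nat.mul_le_mul_right d (Nat.succ_le_of_lt j.2)]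
  have hcollection := getD_flatMap_const (f := fun i => (List.finRange n).flatMap fun j =>
    (List.finRange d).map fun l => (A i j l).toNat) (m := n * d) (fun i => by
      rw [length_flatMap_const (m := d)] <;> simp) (List.finRange k) ⟨i, by simp⟩ hjl
  have hvector := getD_flatMap_const (f := fun j => (List.finRange d).map fun l => (A i j l).toNat)
    (m := d) (fun _ => by simp) (List.finRange n) ⟨j, by simp⟩ l.2
  simp only [Fin.getElem_fin, List.getElem_finRange, Fin.cast_mk, Fin.eta] at hcollection hvector
  rw [hindex, ovInput, List.getD_cons_succ, List.getD_cons_succ, hcollection, hvector]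
  simp

theorem le_of_mem_ovInput {x : ℕ} (hx : x ∈ ovInput A) : x ≤ n + d + 1 := by
  simp only [ovInput, List.mem_cons, List.mem_flatMap, List.mem_map] at hx
  rcases hx with rfl | rfl | ⟨i, -, j, -, l, -, rfl⟩
  · omega
  · omega
  · exact (Bool.toNat_le _).trans (Nat.le_add_left _ _)

theorem hasOrthogonalTuple_iff :
    HasOrthogonalTuple A ↔ ∃ v : Fin k → Fin n, ∀ l, ∃ i, A i (v i) l = false := by
  simp [HasOrthogonalTuple, Finset.prod_eq_zero_iff]

end Encoding

namespace Layered

section Extension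

variable {K n d : ℕ} {inp : ℕ → ℕ} (A : Fin (K + 1) → Fin n → Fin d → Bool)

theorem extBit_zero (p : ℕ) (x : Fin (d + K + 1)) : extBit K n d inp p 0 x :=
  .inl (by simp)

theorem exists_forall_extBit :
    ∃ x : Fin (d + K + 1), ∀ p < K, ∀ v, extBit K n d inp p v x :=
  ⟨⟨d + K, by omega⟩, fun p hp _ => .inr (.inl ⟨by simp, by simp; omega⟩)⟩

theorem extBit_iff_of_le {p : ℕ} {v : Fin (n + 1)} {x : Fin (d + K + 1)} (hx : d ≤ x) :
    extBit K n d inp p v x ↔ v = 0 ∨ (x : ℕ) ≠ d + p := by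
  simp [extBit, hx, hx.not_gt]

theorem extBit_succ_iff (i : Fin (K + 1)) (j : Fin n) (l : Fin d) {x : Fin (d + K + 1)}
    (hx : (x : ℕ) = l) :
    extBit K n d (memOfList (ovInput A)) i j.succ x ↔ A i j l = true := by
  have hl := l.2
  have hmem : memOfList (ovInput A) (2 + ((i * n + j) * d + l)) = (A i j l).toNat :=
    getD_ovInput A i j l
  simp [extBit, hx, hl, hl.not_ge, hmem]

theorem exists_orthogonal_iff :
    (∃ v : ℕ → Fin (n + 1), ¬ ∃ x, ∀ p ≤ K, extBit K n d (memOfList (ovInput A)) p (v p) x) ↔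
      HasOrthogonalTuple A := by
  rw [hasOrthogonalTuple_iff]
  constructor
  · rintro ⟨v, hv⟩
    have hne (p : Fin (K + 1)) : v p ≠ 0 := fun hp => hv ⟨⟨d + p, by omega⟩, fun q _ =>
      (extBit_iff_of_le (Nat.le_add_right d p)).2 <| by
        by_cases hqp : q = p
        · exact .inl (hqp ▸ hp)
        · exact .inr (by simpa using Ne.symm hqp)⟩
    choose u hu using fun p => Fin.exists_succ_eq.2 (hne p)
    refine ⟨u, fun l => ?_⟩
    by_contra! hall
    refine hv ⟨⟨l, by omega⟩, fun p hp => ?_⟩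
    have hbit := (extBit_succ_iff A ⟨p, by omega⟩ _ l (x := ⟨l, by omega⟩) rfl).2
      (by simpa using hall ⟨p, by omega⟩)
    rwa [hu] at hbit
  · rintro ⟨u, hu⟩
    let v (p : ℕ) : Fin (n + 1) := if h : p < K + 1 then (u ⟨p, h⟩).succ else 0
    have hvu (i : Fin (K + 1)) : v i = (u i).succ := dif_pos i.2
    refine ⟨v, fun ⟨x, hx⟩ => ?_⟩
    rcases lt_or_ge (x : ℕ) d with hxd | hxd
    · obtain ⟨i, hi⟩ := hu ⟨x, hxd⟩
      have hbit := hx i (by omega)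
      rw [hvu, extBit_succ_iff A i _ ⟨x, hxd⟩ rfl, hi] at hbit
      exact Bool.noConfusion hbit
    · have hbit := hx (x - d) (by omega)
      rw [extBit_iff_of_le hxd, hvu ⟨x - d, by omega⟩] at hbit
      exact hbit.elim (Fin.succ_ne_zero _) fun h => h (by omega)

/-- Correct outputs for `task` are at most `θ` at vertices of eccentricity at most `lo` and larger
than `θ` at vertices of eccentricity at least `hi`. -/
def Separates (lo hi θ : ℕ) (task : GraphTask) : Prop :=
  ∀ (n : ℕ) (G : SimpleGraph (Fin n)) (o : ℕ → ℕ), G.Connected → task n G o → ∀ v,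
    (G.eccent v ≤ lo → o v ≤ θ) ∧ (hi ≤ G.eccent v → θ < o v)

theorem exists_lt_source_iff (hK : K ≠ 0) {θ : ℕ} {task : GraphTask} {o : ℕ → ℕ}
    (h : Separates (2 * K + 1) (4 * K + 1) θ task)
    (ho : task _ (graph K (extBit K n d (memOfList (ovInput A)))) o) :
    (∃ a, θ < o (source K (n + 1) (d + K + 1) a)) ↔ HasOrthogonalTuple A := by
  have hout := h _ _ o (connected_graph extBit_zero exists_forall_extBit hK) ho
  rw [← exists_orthogonal_iff]
  constructor
  · rintro ⟨a, ha⟩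
    by_contra! hcommon
    exact ha.not_ge ((hout _).1 (eccent_source_le extBit_zero hcommon hK a))
  · rintro ⟨v, hv⟩
    exact ⟨_, (hout _).2 (le_eccent_source extBit_zero hv hK)⟩

end Extension

/-! ### Word sizes -/

/-- The numbers `f n d` fit into words with `O(log (n * d))` bits. -/
def FitsInWords (f : ℕ → ℕ → ℕ) : Prop :=
  ∃ c, ∀ n d, 1 ≤ n → 1 ≤ d → f n d < 2 ^ wordSize c (n * d)

namespace FitsInWords

variable {f g : ℕ → ℕ → ℕ}

theorem const (c : ℕ) : FitsInWords fun _ _ => c :=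
  ⟨c, fun _ _ _ _ => Nat.lt_two_pow_self.trans_le
    (Nat.pow_le_pow_right two_pos (Nat.le_mul_of_pos_right _ (Nat.succ_pos _)))⟩

theorem fst : FitsInWords fun n _ => n :=
  ⟨1, fun n d _ hd => (Nat.le_mul_of_pos_right n hd).trans_lt <| by
    simpa only [wordSize, one_mul] using Nat.lt_pow_succ_log_self one_lt_two (n * d)⟩

theorem snd : FitsInWords fun _ d => d :=
  ⟨1, fun n d hn _ => (Nat.le_mul_of_pos_left d hn).trans_lt <| by
    simpa only [wordSize, one_mul] using Nat.lt_pow_succ_log_self one_lt_two (n * d)⟩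

theorem mul (hf : FitsInWords f) (hg : FitsInWords g) : FitsInWords fun n d => f n d * g n d := by
  obtain ⟨a, ha⟩ := hf
  obtain ⟨b, hb⟩ := hg
  refine ⟨a + b, fun n d hn hd => ?_⟩
  rw [wordSize, add_mul, pow_add]
  exact Nat.mul_lt_mul'' (ha n d hn hd) (hb n d hn hd)

theorem add (hf : FitsInWords f) (hg : FitsInWords g) : FitsInWords fun n d => f n d + g n d := by
  obtain ⟨a, ha⟩ := hf
  obtain ⟨b, hb⟩ := hg
  refine ⟨a + b + 1, fun n d hn hd => ?_⟩
  have hpow {e e' : ℕ} (h : e ≤ e') : 2 ^ wordSize e (n * d) ≤ 2 ^ wordSize e' (n * d) :=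
    Nat.pow_le_pow_right two_pos (Nat.mul_le_mul_right _ h)
  calc f n d + g n d < 2 ^ wordSize (a + b) (n * d) + 2 ^ wordSize (a + b) (n * d) :=
        add_lt_add ((ha n d hn hd).trans_le (hpow (Nat.le_add_right a b)))
          ((hb n d hn hd).trans_le (hpow (Nat.le_add_left b a)))
    _ = 2 ^ (wordSize (a + b) (n * d) + 1) := by rw [pow_succ, mul_two]
    _ ≤ 2 ^ wordSize (a + b + 1) (n * d) := Nat.pow_le_pow_right two_pos <| by
        simp only [wordSize, add_mul]
        omega

theorem pow (hf : FitsInWords f) (m : ℕ) : FitsInWords fun n d => f n d ^ m := by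
  induction m with
  | zero => simpa using const 1
  | succ m ih => simpa only [pow_succ] using ih.mul hf

theorem two_pow_wordSize (hf : FitsInWords f) (c : ℕ) :
    FitsInWords fun n d => 2 ^ wordSize c (f n d) := by
  obtain ⟨a, ha⟩ := hf
  refine ⟨c * (a + 1) + 1, fun n d hn hd => Nat.pow_lt_pow_right one_lt_two ?_⟩
  have hlog : Nat.log 2 (f n d) ≤ a * (Nat.log 2 (n * d) + 1) :=
    (Nat.log_mono_right (ha n d hn hd).le).trans_eq (Nat.log_pow one_lt_two _)
  unfold wordSize
  nlinarith only [Nat.mul_le_mul_left c hlog, Nat.zero_le (c * Nat.log 2 (n * d)),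
    Nat.zero_le (Nat.log 2 (n * d))]

end FitsInWords

theorem fitsInWords_order (K : ℕ) : FitsInWords fun n d => order K (n + 1) (d + K + 1) :=
  (FitsInWords.const _).mul (((FitsInWords.fst.add (.const 1)).pow K).mul
    (((FitsInWords.snd.add (.const K)).add (.const 1)).pow K))

/-! ### Lower bounds from the orthogonal vectors conjecture -/

variable {K C θ : ℕ} {task : GraphTask} {T : ℕ → ℝ}

theorem add_le_mul_add_one {n d : ℕ} (hn : 1 ≤ n) (hd : 1 ≤ d) :
    n + d ≤ (K + 1) * n * d + 1 := by
  obtain ⟨n, rfl⟩ := Nat.exists_eq_add_of_le' hn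
  obtain ⟨d, rfl⟩ := Nat.exists_eq_add_of_le' hd
  nlinarith only [Nat.zero_le (n * d), Nat.zero_le (K * ((n + 1) * (d + 1)))]

theorem exists_program (hK : K ≠ 0) (hC : 2 ≤ C) (h : Separates (2 * K + 1) (4 * K + 1) θ task)
    (hT : SolvableOnSparse C task T) :
    ∃ (p : Prog) (c : ℕ) (a : ℕ), ∀ n d : ℕ, 1 ≤ n → 1 ≤ d →
      ∀ A : Fin (K + 1) → Fin n → Fin d → Bool,
        RunsWithin p (wordSize c (n * d)) (ovInput A)
          (a * order K (n + 1) (d + K + 1) + 2 * T (order K (n + 1) (d + K + 1)))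
          (fun out => out 0 ≠ 0 ↔ HasOrthogonalTuple A) := by
  obtain ⟨p, c, hp⟩ := hT
  let B (n d : ℕ) : ℕ := 2 ^ wordSize c (order K (n + 1) (d + K + 1)) +
    (inputLength K n d + 4 * order K (n + 1) (d + K + 1) + 2)
  have hlength : FitsInWords (inputLength K) :=
    (FitsInWords.const 2).add (((FitsInWords.const (K + 1)).mul .fst).mul .snd)
  have hB : FitsInWords fun n d => B n d ^ reductionSize K θ p :=
    (((fitsInWords_order K).two_pow_wordSize c).add
      ((hlength.add ((FitsInWords.const 4).mul (fitsInWords_order K))).add (.const 2))).pow _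
  obtain ⟨c', hc'⟩ := hB
  refine ⟨reduction K θ p, c',
    (writeGraph K p.regBound).cost 1 + (scan K p.regBound θ).cost 1, fun n d hn hd A => ?_⟩
  have hle (a : ℕ) : memOfList (ovInput A) a ≤ B n d := memOfList_le (fun x hx =>
    (le_of_mem_ovInput A hx).trans <| by
      have hsum := add_le_mul_add_one (K := K) hn hd
      have hpos := Nat.two_pow_pos (wordSize c (order K (n + 1) (d + K + 1)))
      unfold B inputLength
      omega) a
  have hedges : (edgeList K (extBit K n d (memOfList (ovInput A)))).length ≤
      C * order K (n + 1) (d + K + 1) :=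
    length_edgeList_le.trans (Nat.mul_le_mul_right _ hC)
  obtain ⟨t, s, hs, ht, o, ho, hso⟩ := runsWithin_reduction (length_ovInput A) rfl rfl hle le_rfl
    (hc' n d hn hd) (hp _ _ _ (connected_graph extBit_zero exists_forall_extBit hK)
      (isEdgeList_edgeList extBit_zero hK) hedges)
  exact ⟨t, s, hs, ht, hso.trans (exists_lt_source_iff A hK h ho)⟩

theorem order_le (K : ℕ) {n d : ℕ} (hn : 1 ≤ n) (hd : 1 ≤ d) :
    order K (n + 1) (d + K + 1) ≤ (3 * K + 2) * (2 ^ K * (K + 2) ^ K) * (n ^ K * d ^ K) := by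
  have hpow_n : (n + 1) ^ K ≤ (2 * n) ^ K := Nat.pow_le_pow_left (by omega) K
  have hpow_d : (d + K + 1) ^ K ≤ ((K + 2) * d) ^ K := Nat.pow_le_pow_left (by nlinarith) K
  calc order K (n + 1) (d + K + 1) ≤ (3 * K + 2) * ((2 * n) ^ K * ((K + 2) * d) ^ K) :=
        Nat.mul_le_mul_left _ (Nat.mul_le_mul hpow_n hpow_d)
    _ = (3 * K + 2) * (2 ^ K * (K + 2) ^ K) * (n ^ K * d ^ K) := by rw [mul_pow, mul_pow]; ring

theorem rpow_order_le (hK : K ≠ 0) {n d : ℕ} (hn : 1 ≤ n) (hd : 1 ≤ d) {δ : ℝ} (hδ : 0 ≤ δ)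
    (hδK : δ ≤ 1 / K) :
    (order K (n + 1) (d + K + 1) : ℝ) ^ (1 + 1 / (K : ℝ) - δ) ≤
      (((3 * K + 2) * (2 ^ K * (K + 2) ^ K) : ℕ) : ℝ) ^ (1 + 1 / (K : ℝ) - δ) *
        ((n : ℝ) ^ (((K + 1 : ℕ) : ℝ) - K * δ) * (d : ℝ) ^ (K + 1)) := by
  set e : ℝ := 1 + 1 / (K : ℝ) - δ with he
  have hKe : (K : ℝ) * e = ((K + 1 : ℕ) : ℝ) - K * δ := by
    rw [he]; push_cast; field_simp
  have hd' : (1 : ℝ) ≤ d := mod_cast hd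
  have hbound : (order K (n + 1) (d + K + 1) : ℝ) ≤
      ((3 * K + 2) * (2 ^ K * (K + 2) ^ K) : ℕ) * ((n : ℝ) ^ K * (d : ℝ) ^ K) :=
    mod_cast order_le K hn hd
  refine (Real.rpow_le_rpow (by positivity) hbound (by linarith)).trans ?_
  rw [Real.mul_rpow (by positivity) (by positivity), Real.mul_rpow (by positivity) (by positivity),
    ← Real.rpow_natCast (n : ℝ) K, ← Real.rpow_natCast (d : ℝ) K, ← Real.rpow_mul (by positivity),
    ← Real.rpow_mul (by positivity), hKe, ← Real.rpow_natCast (d : ℝ) (K + 1)]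
  gcongr
  exact sub_le_self _ (by positivity)

theorem not_solvableOnSparse (hK : K ≠ 0) (hOV : KOVConjecture (K + 1)) (hC : 2 ≤ C)
    (h : Separates (2 * K + 1) (4 * K + 1) θ task) {c ε : ℝ} (hε : 0 < ε)
    (hT : ∀ n : ℕ, 1 ≤ n → T n ≤ c * (n : ℝ) ^ (1 + 1 / (K : ℝ) - ε)) :
    ¬ SolvableOnSparse C task T := by
  intro hsol
  obtain ⟨p, w, a, hp⟩ := exists_program hK hC h hsol
  have hK₀ : (0 : ℝ) < K := mod_cast Nat.pos_of_ne_zero hK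
  let δ := min ε (1 / (K : ℝ))
  have hδ : 0 < δ := lt_min hε (by positivity)
  have hδK : δ ≤ 1 / (K : ℝ) := min_le_right _ _
  let e : ℝ := 1 + 1 / (K : ℝ) - δ
  refine hOV (K * δ) (by positivity) ⟨p, w,
    (a + 2 * |c|) * (((3 * K + 2) * (2 ^ K * (K + 2) ^ K) : ℕ) : ℝ) ^ e, K + 1,
    fun n d hn hd A => ?_⟩
  obtain ⟨t, s, hs, ht, hQ⟩ := hp n d hn hd A
  refine ⟨t, s, hs, ht.trans ?_, hQ⟩
  set N := order K (n + 1) (d + K + 1)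
  have hN : (1 : ℝ) ≤ N := mod_cast (NeZero.one_le : 1 ≤ N)
  have hlinear : (N : ℝ) ≤ (N : ℝ) ^ e :=
    Real.self_le_rpow_of_one_le hN (by simp only [e]; linarith)
  have htime : T N ≤ |c| * (N : ℝ) ^ e :=
    (hT N NeZero.one_le).trans (mul_le_mul (le_abs_self c) (Real.rpow_le_rpow_of_exponent_le hN
      (sub_le_sub_left (min_le_left _ _) _)) (by positivity) (abs_nonneg c))
  calc (a : ℝ) * N + 2 * T N ≤ (a + 2 * |c|) * (N : ℝ) ^ e := by
        linarith [mul_le_mul_of_nonneg_left hlinear a.cast_nonneg]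
    _ ≤ (a + 2 * |c|) * ((((3 * K + 2) * (2 ^ K * (K + 2) ^ K) : ℕ) : ℝ) ^ e *
          ((n : ℝ) ^ (((K + 1 : ℕ) : ℝ) - K * δ) * (d : ℝ) ^ (K + 1))) :=
        mul_le_mul_of_nonneg_left (rpow_order_le hK hn hd hδ.le hδK) (by positivity)
    _ = _ := by ring

/-! ### Approximation algorithms -/

theorem eccent_ne_top {n : ℕ} {G : SimpleGraph (Fin n)} (hG : G.Connected) (v : Fin n) :
    G.eccent v ≠ ⊤ := by
  obtain ⟨u, hu⟩ := G.exists_edist_eq_eccent_of_finite v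
  rw [← hu]
  exact SimpleGraph.edist_ne_top_iff_reachable.2 (hG.preconnected v u)

variable {lo hi : ℕ} {ρ : ℝ}

theorem separates_eccGap : Separates lo hi 0 (eccGap lo hi) := fun _ _ _ _ ho v =>
  ⟨fun h => ((ho v).1 h).le, fun h => Nat.pos_of_ne_zero ((ho v).2 h)⟩

theorem separates_eccApproxAbove (hρ : ρ * lo < (hi + 1 : ℕ)) :
    Separates lo (hi + 1) hi (eccApproxAbove ρ) := by
  intro n G o hG ho v
  obtain ⟨hle, hge⟩ := ho v
  obtain ⟨x, hx⟩ := ENat.ne_top_iff_exists.1 (eccent_ne_top hG v)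
  rw [← hx] at hle hge ⊢
  simp only [ENat.toNat_natCast, Nat.cast_le] at hle hge ⊢
  refine ⟨fun hlo => ?_, fun hhi => hhi.trans hle⟩
  suffices (o v : ℝ) < (hi + 1 : ℕ) from Nat.le_of_lt_succ (mod_cast this)
  rcases le_or_gt 0 ρ with hpos | hneg
  · exact hge.trans_lt ((mul_le_mul_of_nonneg_left (mod_cast hlo) hpos).trans_lt hρ)
  · exact hge.trans_lt ((mul_nonpos_of_nonpos_of_nonneg hneg.le x.cast_nonneg).trans_lt
      (mod_cast hi.succ_pos))

theorem separates_eccApproxBelow (hρ : ρ * lo < (hi + 1 : ℕ)) :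
    Separates lo (hi + 1) lo (eccApproxBelow ρ) := by
  intro n G o hG ho v
  obtain ⟨hle, hge⟩ := ho v
  obtain ⟨x, hx⟩ := ENat.ne_top_iff_exists.1 (eccent_ne_top hG v)
  rw [← hx] at hle hge ⊢
  simp only [ENat.toNat_natCast, Nat.cast_le] at hle hge ⊢
  refine ⟨hle.trans, fun hhi => ?_⟩
  have hhi' : ((hi + 1 : ℕ) : ℝ) ≤ x := mod_cast hhi
  by_contra! hsmall
  rcases le_or_gt 0 ρ with hpos | hneg
  · exact (hhi'.trans hge).not_gt
      ((mul_le_mul_of_nonneg_left (mod_cast hsmall) hpos).trans_lt hρ)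
  · exact (hhi'.trans hge).not_gt ((mul_nonpos_of_nonpos_of_nonneg hneg.le
      (o v).cast_nonneg).trans_lt (mod_cast hi.succ_pos))

theorem not_solvableOnSparse_eccApprox (hK : K ≠ 0) (hOV : KOVConjecture (K + 1)) (hC : 2 ≤ C)
    (hρ : ρ * (2 * K + 1 : ℕ) < (4 * K + 1 : ℕ)) {T : ℝ → ℕ → ℝ} {ε : ℝ} (hε : 0 < ε)
    (hT : ∀ c, ∃ c', ∀ n : ℕ, 1 ≤ n → T c n ≤ c' * (n : ℝ) ^ (1 + 1 / (K : ℝ) - ε)) :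
    (¬ ∃ c, SolvableOnSparse C (eccApproxAbove ρ) (T c)) ∧
      ¬ ∃ c, SolvableOnSparse C (eccApproxBelow ρ) (T c) := by
  constructor <;> rintro ⟨c, hsol⟩ <;> obtain ⟨c', hc'⟩ := hT c
  · exact not_solvableOnSparse hK hOV hC (separates_eccApproxAbove hρ) hε hc' hsol
  · exact not_solvableOnSparse hK hOV hC (separates_eccApproxBelow hρ) hε hc' hsol

theorem exists_rpow_le_of_tendsto {g : ℕ → ℝ} (hg : Tendsto g atTop (𝓝 0)) {η : ℝ} (hη : 0 < η)
    (c : ℝ) : ∃ c', ∀ n : ℕ, 1 ≤ n → c * (n : ℝ) ^ (1 + g n) ≤ c' * (n : ℝ) ^ (1 + η) := by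
  obtain ⟨n₀, hn₀⟩ := eventually_atTop.1 (hg.eventually (gt_mem_nhds hη))
  have hterm (i : ℕ) : (0 : ℝ) ≤ (i : ℝ) ^ (1 + g i) := by positivity
  let S : ℝ := ∑ i ∈ Finset.range n₀, (i : ℝ) ^ (1 + g i)
  have hS : 0 ≤ S := Finset.sum_nonneg fun i _ => hterm i
  refine ⟨|c| * (1 + S), fun n hn => ?_⟩
  have hn' : (1 : ℝ) ≤ n := mod_cast hn
  have hone : (1 : ℝ) ≤ (n : ℝ) ^ (1 + η) := Real.one_le_rpow hn' (by linarith)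
  have hbound : (n : ℝ) ^ (1 + g n) ≤ (1 + S) * (n : ℝ) ^ (1 + η) := by
    rcases le_or_gt n₀ n with hlarge | hsmall
    · have := Real.rpow_le_rpow_of_exponent_le hn' (add_le_add_right (hn₀ n hlarge).le 1)
      nlinarith
    · have := Finset.single_le_sum (fun i _ => hterm i) (Finset.mem_range.2 hsmall)
      nlinarith
  calc c * (n : ℝ) ^ (1 + g n) ≤ |c| * (n : ℝ) ^ (1 + g n) :=
        mul_le_mul_of_nonneg_right (le_abs_self c) (hterm n)
    _ ≤ |c| * ((1 + S) * (n : ℝ) ^ (1 + η)) := mul_le_mul_of_nonneg_left hbound (abs_nonneg c)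
    _ = |c| * (1 + S) * (n : ℝ) ^ (1 + η) := (mul_assoc _ _ _).symm

end Layered

theorem mainTheorem5 :
    -- the gap problem needs time `n ^ (1 + 1/(k-1) - o(1))` under the `k`-OV conjecture
    (∀ k : ℕ, 2 ≤ k → KOVConjecture k →
      ∀ C : ℕ, 2 ≤ C → ∀ ε : ℝ, 0 < ε →
        ¬ ∃ K : ℝ, SolvableOnSparse C (eccGap (2 * k - 1) (4 * k - 3))
          (fun n => K * (n : ℝ) ^ (1 + 1 / ((k : ℝ) - 1) - ε))) ∧
    -- no `(9/5 - ε)`-approximation in time `O(n ^ (3/2 - δ))`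
    (KOVConjecture 3 →
      ∀ C : ℕ, 2 ≤ C → ∀ ε δ : ℝ, 0 < ε → 0 < δ →
        (¬ ∃ K : ℝ, SolvableOnSparse C (eccApproxAbove (9 / 5 - ε))
          (fun n => K * (n : ℝ) ^ (3 / 2 - δ))) ∧
        (¬ ∃ K : ℝ, SolvableOnSparse C (eccApproxBelow (9 / 5 - ε))
          (fun n => K * (n : ℝ) ^ (3 / 2 - δ)))) ∧
    -- no `(2 - ε)`-approximation in time `n ^ (1 + o(1))`
    ((∀ k : ℕ, 2 ≤ k → KOVConjecture k) →
      ∀ C : ℕ, 2 ≤ C → ∀ ε : ℝ, 0 < ε →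
        ∀ g : ℕ → ℝ, Tendsto g atTop (𝓝 0) →
          (¬ ∃ K : ℝ, SolvableOnSparse C (eccApproxAbove (2 - ε))
            (fun n => K * (n : ℝ) ^ (1 + g n))) ∧
          (¬ ∃ K : ℝ, SolvableOnSparse C (eccApproxBelow (2 - ε))
            (fun n => K * (n : ℝ) ^ (1 + g n)))) := by
  refine ⟨fun k hk hOV C hC ε hε => ?_, fun hOV C hC ε δ hε hδ => ?_,
    fun hOV C hC ε hε g hg => ?_⟩
  · obtain ⟨K, rfl⟩ := Nat.exists_eq_add_of_le' (show 1 ≤ k by omega)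
    rintro ⟨c, hsol⟩
    rw [show 2 * (K + 1) - 1 = 2 * K + 1 by omega,
      show 4 * (K + 1) - 3 = 4 * K + 1 by omega] at hsol
    exact Layered.not_solvableOnSparse (c := c) (by omega) hOV hC Layered.separates_eccGap hε
      (by simp) hsol
  · exact Layered.not_solvableOnSparse_eccApprox (K := 2) two_ne_zero hOV hC
      (by norm_num; linarith) hδ fun c => ⟨c, by norm_num⟩
  · obtain ⟨K, hK⟩ := exists_nat_gt (1 / ε)
    have hK₀ : (0 : ℝ) < K := lt_trans (by positivity) hK
    have hρ : (2 - ε) * (2 * K + 1 : ℕ) < (4 * K + 1 : ℕ) := by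
      push_cast
      nlinarith [(div_lt_iff₀ hε).1 hK]
    have hexp : 1 + 1 / (K : ℝ) - 1 / (2 * K) = 1 + 1 / (2 * K) := by field_simp; ring
    refine Layered.not_solvableOnSparse_eccApprox (mod_cast hK₀.ne')
      (hOV (K + 1) ?_) hC hρ (ε := 1 / (2 * K)) (by positivity) fun c => ?_
    · have : 0 < K := mod_cast hK₀
      omega
    · rw [hexp]
      exact Layered.exists_rpow_le_of_tendsto hg (by positivity) c
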